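/- Let $n\ge 8$ and $m>0$. Let $R_0=(m/2)^{1/(n-2)}$, and let the $n$-dimensional Riemannian Schwarzschild space be $M^n=\{x\in\mathbb R^n : |x|\ge R_0\}$ with the metric $g_{Sch}=\left(1+\frac{m}{2|x|^{n-2}}\right)^{4/(n-2)}\delta$, where $\delta$ is the Euclidean metric. A properly embedded free boundary minimal hypersurface $\Sigma\subset M$ is a closed subset that is a smooth hypersurface with nonempty boundary $\partial\Sigma=\Sigma\cap\partial M$, has zero mean curvature and meets $\partial M=\{|x|=R_0\}$ orthogonally along $\partial\Sigma$. For such $\Sigma$ with unit normal $\xi$ and for $R>R_0$ put $\Sigma(R)=\Sigma\cap\{|x|\le R\}$. For smooth $u$ on $\Sigma(R)$ vanishing on $\Sigma\cap\{|x|=R\}$ let $$Q(u,u)=\int_{\Sigma(R)}\Big(|\nabla_\Sigma u|^2-\big(\mathrm{Ric}(\xi,\xi)+|A_\Sigma|^2\big)u^2\Big)\,dv-\int_{\partial\Sigma}A_{\partial M}(\xi,\xi)\,u^2\,ds ,$$ where $A_{\partial M}$ is the second fundamental form of $\partial M$ with respect to the unit normal pointing into $M$. Let $\mathrm{Ind}_F(\Sigma(R))$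 be the maximal dimension of a linear space of such functions on which $Q$ is negative definite; the Morse index of $\Sigma$ is $\limsup_{R\to\infty}\mathrm{Ind}_F(\Sigma(R))\in\{0,1,\dots,\infty\}$. (1) There is a properly embedded free boundary minimal hypersurface in $(M^n,g_{Sch})$ that is not totally geodesic and has Morse index $0$. (2) More precisely, let $1\le k\le n-3$ and let $$\Gamma=\mathbb S^{k}\Big(\sqrt{\tfrac{k}{n-2}}\Big)\times\mathbb S^{n-2-k}\Big(\sqrt{\tfrac{n-2-k}{n-2}}\Big)\subset\mathbb S^{n-1}\subset\mathbb R^{k+1}\times\mathbb R^{n-1-k}$$ be the Clifford torus. Then $\Gamma$ is a closed embedded minimal hypersurface of $\mathbb S^{n-1}$; its second fundamental form in $\mathbb S^{n-1}$ has constant squared norm $|A_\Gamma|^2=n-2$; and the smallest eigenvalue of its Jacobi operator $J_\Gamma f=-\Delta_\Gamma f-|A_\Gamma|^2f$ is $\lambda_1=-(n-2)$. The cone $\Sigma_\Gamma=\{ty : t>0,\ y\in\Gamma\}\cap\{|x|\ge R_0\}$ is a properly embedded free boundary minimal hypersurface of $(M^n,g_{Sch})$ that is not totally geodesic and has Morse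 index $0$. -/

import Mathlib

open scoped ContDiff
open MeasureTheory

noncomputable section

/-- Euclidean space `ℝⁿ`. -/
abbrev Euc (n : ℕ) : Type := EuclideanSpace ℝ (Fin n)

/-! ### Riemannian metrics on (open subsets of) `ℝⁿ`, in the global chart -/

/-- A field of bilinear forms `g x v w` on `ℝⁿ`. -/
abbrev MetricField (n : ℕ) : Type := Euc n → Euc n → Euc n → ℝ

/-- The `k`-th standard basis vector. -/
def stdVec {n : ℕ} (k : Fin n) : Euc n := EuclideanSpace.single k 1

/-- The trace of a linear endomorphism of `ℝⁿ`. -/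
def coordTrace {n : ℕ} (T : Euc n → Euc n) : ℝ := ∑ k, T (stdVec k) k

/-- The matrix `(g_{ij}(x))`. -/
def gramMatrix {n : ℕ} (g : MetricField n) (x : Euc n) : Matrix (Fin n) (Fin n) ℝ :=
  Matrix.of fun i j => g x (stdVec i) (stdVec j)

/-- The vector representing the linear functional `ℓ` with respect to `g x`:
`g x (raiseIndex g x ℓ) z = ℓ z`. -/
def raiseIndex {n : ℕ} (g : MetricField n) (x : Euc n) (ℓ : Euc n → ℝ) : Euc n :=
  ∑ i, (∑ j, (gramMatrix g x)⁻¹ i j * ℓ (stdVec j)) • stdVec i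

/-- The Christoffel symbols of the Levi-Civita connection of `g`, as the vector `Γ_x(v, w)`. -/
def christoffel {n : ℕ} (g : MetricField n) (x v w : Euc n) : Euc n :=
  raiseIndex g x fun z =>
    (1 / 2 : ℝ) * (fderiv ℝ (fun y => g y w z) x v + fderiv ℝ (fun y => g y v z) x w
      - fderiv ℝ (fun y => g y v w) x z)

/-- The Levi-Civita covariant derivative `∇_v X` at `x`. -/
def covDeriv {n : ℕ} (g : MetricField n) (X : Euc n → Euc n) (x v : Euc n) : Euc n :=
  fderiv ℝ X x v + christoffel g x v (X x)

/-- The curvature tensor `R(u, v) w = ∇_u ∇_v w - ∇_v ∇_u w - ∇_{[u,v]} w` at `x`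
(evaluated on constant vector fields, for which the bracket vanishes). -/
def curvatureTensor {n : ℕ} (g : MetricField n) (x u v w : Euc n) : Euc n :=
  fderiv ℝ (fun y => christoffel g y v w) x u - fderiv ℝ (fun y => christoffel g y u w) x v
    + christoffel g x u (christoffel g x v w) - christoffel g x v (christoffel g x u w)

/-- The Ricci curvature `Ric(v, w) = tr (u ↦ R(u, v) w)`. -/
def ricciCurvature {n : ℕ} (g : MetricField n) (x v w : Euc n) : ℝ :=
  coordTrace fun u => curvatureTensor g x u v w

/-- The gradient of `u` with respect to `g`. -/
def metricGradient {n : ℕ} (g : MetricField n) (u : Euc n → ℝ) (x : Euc n) : Euc n :=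
  raiseIndex g x fun z => fderiv ℝ u x z

/-! ### Hypersurfaces of `ℝⁿ` and their geometry with respect to `g` -/

/-- Near `p`, the set `S` is a smooth hypersurface without boundary, with tangent space `T` at `p`:
it is the zero set of a submersion. -/
def IsInteriorPoint {n : ℕ} (S : Set (Euc n)) (p : Euc n) (T : Set (Euc n)) : Prop :=
  ∃ (U : Set (Euc n)) (φ : Euc n → ℝ), IsOpen U ∧ p ∈ U ∧ ContDiffOn ℝ ∞ φ U ∧ φ p = 0 ∧
    fderiv ℝ φ p ≠ 0 ∧ S ∩ U = {x | x ∈ U ∧ φ x = 0} ∧ T = {v | fderiv ℝ φ p v = 0}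

/-- Near `p`, the set `S` is a smooth hypersurface with boundary, `p` is one of its boundary points,
and `T` is the tangent space at `p`: the set `S` is cut out as `φ = 0`, `ψ ≥ 0`, where `φ` and `ψ`
vanish at `p` and have linearly independent differentials there. -/
def IsBoundaryPoint {n : ℕ} (S : Set (Euc n)) (p : Euc n) (T : Set (Euc n)) : Prop :=
  ∃ (U : Set (Euc n)) (φ ψ : Euc n → ℝ), IsOpen U ∧ p ∈ U ∧ ContDiffOn ℝ ∞ φ U ∧
    ContDiffOn ℝ ∞ ψ U ∧ φ p = 0 ∧ ψ p = 0 ∧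
    LinearIndependent ℝ ![fderiv ℝ φ p, fderiv ℝ ψ p] ∧
    S ∩ U = {x | x ∈ U ∧ φ x = 0 ∧ 0 ≤ ψ x} ∧ T = {v | fderiv ℝ φ p v = 0}

/-- `S` is a properly embedded smooth hypersurface of `{x | R₀ ≤ ‖x‖}`: a closed subset which is a
smooth hypersurface with boundary, such that `∂S` is the intersection of `S` with `{‖x‖ = R₀}`. -/
structure IsProperlyEmbedded {n : ℕ} (R₀ : ℝ) (S : Set (Euc n)) : Prop where
  nonempty : S.Nonempty
  isClosed : IsClosed S
  subset : ∀ p ∈ S, R₀ ≤ ‖p‖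
  interior_point : ∀ p ∈ S, R₀ < ‖p‖ → ∃ T, IsInteriorPoint S p T
  boundary_point : ∀ p ∈ S, ‖p‖ = R₀ → ∃ T, IsBoundaryPoint S p T

/-- `ξ` is (a smooth extension to a neighbourhood of `S` of) a unit normal field along `S`. -/
structure IsUnitNormal {n : ℕ} (g : MetricField n) (S : Set (Euc n)) (ξ : Euc n → Euc n) :
    Prop where
  smooth : ∃ U : Set (Euc n), IsOpen U ∧ S ⊆ U ∧ ContDiffOn ℝ ∞ ξ U
  unit : ∀ p ∈ S, g p (ξ p) (ξ p) = 1
  normal : ∀ p ∈ S, ∃ T, (IsInteriorPoint S p T ∨ IsBoundaryPoint S p T) ∧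
    ∀ v ∈ T, g p (ξ p) v = 0

/-- The `g`-orthogonal projection of `ℝⁿ` onto the tangent space `ξ(x)^⊥`. -/
def tanProj {n : ℕ} (g : MetricField n) (ξ : Euc n → Euc n) (x v : Euc n) : Euc n :=
  v - g x (ξ x) v • ξ x

/-- The second fundamental form `A(v, w) = -g(∇_v ξ, w)`, for tangent vectors `v`, `w`. -/
def secondFF {n : ℕ} (g : MetricField n) (ξ : Euc n → Euc n) (x v w : Euc n) : ℝ :=
  -g x (covDeriv g ξ x v) w

/-- The shape operator `v ↦ -∇_v ξ` of the tangent space, extended by zero to the normal line. -/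
def shapeOp {n : ℕ} (g : MetricField n) (ξ : Euc n → Euc n) (x v : Euc n) : Euc n :=
  tanProj g ξ x (-covDeriv g ξ x (tanProj g ξ x v))

/-- The mean curvature, the trace of the shape operator. -/
def meanCurvature {n : ℕ} (g : MetricField n) (ξ : Euc n → Euc n) (x : Euc n) : ℝ :=
  coordTrace (shapeOp g ξ x)

/-- `|A|²`, the squared norm of the second fundamental form: the trace of the square of the
(self-adjoint) shape operator. -/
def normSqA {n : ℕ} (g : MetricField n) (ξ : Euc n → Euc n) (x : Euc n) : ℝ :=
  coordTrace fun v => shapeOp g ξ x (shapeOp g ξ x v)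

/-- `|∇_S u|²`, the squared `g`-norm of the tangential gradient of `u`. -/
def normSqTanGrad {n : ℕ} (g : MetricField n) (ξ : Euc n → Euc n) (u : Euc n → ℝ) (x : Euc n) :
    ℝ :=
  g x (tanProj g ξ x (metricGradient g u x)) (tanProj g ξ x (metricGradient g u x))

/-- The second fundamental form vanishes on all tangent spaces of `S`. -/
def IsTotallyGeodesic {n : ℕ} (g : MetricField n) (S : Set (Euc n)) (ξ : Euc n → Euc n) : Prop :=
  ∀ p ∈ S, ∀ v w, g p (ξ p) v = 0 → g p (ξ p) w = 0 → secondFF g ξ p v w = 0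

/-! ### The Riemannian Schwarzschild space of dimension `n` and mass `m` -/

/-- The radius `R₀ = (m/2)^{1/(n-2)}` of the horizon. -/
def horizonRadius (n : ℕ) (m : ℝ) : ℝ := (m / 2) ^ (1 / ((n : ℝ) - 2))

/-- The conformal factor `f = (1 + m / (2 |x|^{n-2}))^{2/(n-2)}`. -/
def schwFactor (n : ℕ) (m : ℝ) (x : Euc n) : ℝ :=
  (1 + m / (2 * ‖x‖ ^ (n - 2))) ^ (2 / ((n : ℝ) - 2))

/-- The Schwarzschild metric `g = f² δ`, considered on `{x | R₀ ≤ ‖x‖}`. -/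
def schwMetric (n : ℕ) (m : ℝ) : MetricField n :=
  fun x v w => schwFactor n m x ^ 2 * inner ℝ v w

/-- The unit normal of the spheres about the origin which along the horizon points
into `{x | R₀ ≤ ‖x‖}`. -/
def radialNormal (n : ℕ) (m : ℝ) (x : Euc n) : Euc n := (schwFactor n m x * ‖x‖)⁻¹ • x

/-- `S`, with unit normal `ξ`, is a properly embedded free boundary minimal hypersurface of the
Schwarzschild space: it is properly embedded, has zero mean curvature, and meets the horizon
orthogonally along its (nonempty) boundary. -/
structure IsFreeBoundaryMinimal (n : ℕ) (m : ℝ) (S : Set (Euc n)) (ξ : Euc n → Euc n) :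
    Prop where
  properly_embedded : IsProperlyEmbedded (horizonRadius n m) S
  unit_normal : IsUnitNormal (schwMetric n m) S ξ
  minimal : ∀ p ∈ S, meanCurvature (schwMetric n m) ξ p = 0
  boundary_nonempty : ∃ p ∈ S, ‖p‖ = horizonRadius n m
  orthogonal : ∀ p ∈ S, ‖p‖ = horizonRadius n m →
    schwMetric n m p (ξ p) (radialNormal n m p) = 0

/-- The quadratic form of the second variation of area on `S(R) = S ∩ {‖x‖ ≤ R}`, for functions `u`
that vanish on `S ∩ {‖x‖ = R}`:
`Q(u, u) = ∫_{S(R)} (|∇u|² - (Ric(ξ, ξ) + |A|²) u²) dv - ∫_{∂S} A_{∂M}(ξ, ξ) u² ds`.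
Since `g = f² δ`, the Riemannian measure of a `d`-dimensional submanifold is `f ^ d` times its
Euclidean `d`-dimensional area. -/
def indexForm (n : ℕ) (m : ℝ) (S : Set (Euc n)) (ξ : Euc n → Euc n) (R : ℝ) (u : Euc n → ℝ) : ℝ :=
  (∫ x in S ∩ {x | ‖x‖ ≤ R},
      (normSqTanGrad (schwMetric n m) ξ u x
        - (ricciCurvature (schwMetric n m) x (ξ x) (ξ x) + normSqA (schwMetric n m) ξ x) * u x ^ 2)
        * schwFactor n m x ^ (n - 1) ∂(Measure.euclideanHausdorffMeasure (n - 1)))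
  - ∫ x in S ∩ {x | ‖x‖ = horizonRadius n m},
      secondFF (schwMetric n m) (radialNormal n m) x (ξ x) (ξ x) * u x ^ 2
        * schwFactor n m x ^ (n - 2) ∂(Measure.euclideanHausdorffMeasure (n - 2))

/-- `V` is a linear space of smooth functions on `S(R)`, vanishing on `S ∩ {‖x‖ = R}`, on which the
second variation is negative definite. Smooth functions on `S(R)` are the restrictions of smooth
functions on `ℝⁿ`. -/
def IsNegativeSpace (n : ℕ) (m : ℝ) (S : Set (Euc n)) (ξ : Euc n → Euc n) (R : ℝ)
    (V : Submodule ℝ (↥(S ∩ {x | ‖x‖ ≤ R}) → ℝ)) : Prop :=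
  ∀ v ∈ V, v ≠ 0 → ∃ u : Euc n → ℝ, ContDiff ℝ ∞ u ∧ (∀ x, u x.1 = v x) ∧
    (∀ x ∈ S, ‖x‖ = R → u x = 0) ∧ indexForm n m S ξ R u < 0

/-- The Morse index of `S(R)` for functions vanishing on `{‖x‖ = R}`: the maximal dimension of a
space on which the second variation is negative definite. -/
def morseIndexAt (n : ℕ) (m : ℝ) (S : Set (Euc n)) (ξ : Euc n → Euc n) (R : ℝ) : ℕ∞ :=
  ⨆ (V : Submodule ℝ (↥(S ∩ {x | ‖x‖ ≤ R}) → ℝ)) (_ : IsNegativeSpace n m S ξ R V),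
    Cardinal.toENat (Module.rank ℝ V)

/-- The Morse index of `S`. -/
def morseIndex (n : ℕ) (m : ℝ) (S : Set (Euc n)) (ξ : Euc n → Euc n) : ℕ∞ :=
  Filter.limsup (fun R : ℝ => morseIndexAt n m S ξ R) Filter.atTop

/-! ### Closed hypersurfaces of the unit sphere `𝕊^{n-1} ⊆ ℝⁿ` -/

/-- Near `p`, the set `Γ` is a smooth hypersurface of the unit sphere, with tangent space `T`. -/
def IsSpherePoint {n : ℕ} (Γ : Set (Euc n)) (p : Euc n) (T : Set (Euc n)) : Prop :=
  ∃ (U : Set (Euc n)) (φ : Euc n → ℝ), IsOpen U ∧ p ∈ U ∧ ContDiffOn ℝ ∞ φ U ∧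
    (∃ v, inner ℝ p v = 0 ∧ fderiv ℝ φ p v ≠ 0) ∧
    Γ ∩ U = {x | x ∈ U ∧ ‖x‖ = 1 ∧ φ x = 0} ∧ T = {v | inner ℝ p v = 0 ∧ fderiv ℝ φ p v = 0}

/-- `η` is (a smooth extension of) a unit normal field of `Γ` in the unit sphere. -/
structure IsSphereUnitNormal {n : ℕ} (Γ : Set (Euc n)) (η : Euc n → Euc n) : Prop where
  smooth : ∃ U : Set (Euc n), IsOpen U ∧ Γ ⊆ U ∧ ContDiffOn ℝ ∞ η U
  unit : ∀ p ∈ Γ, ‖η p‖ = 1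
  tangent_sphere : ∀ p ∈ Γ, inner ℝ p (η p) = 0
  normal : ∀ p ∈ Γ, ∃ T, IsSpherePoint Γ p T ∧ ∀ v ∈ T, inner ℝ (η p) v = 0

/-- The orthogonal projection of `ℝⁿ` onto the tangent space of `Γ` at `x`, which is the orthogonal
complement of `x` and `η x`. -/
def sphTanProj {n : ℕ} (η : Euc n → Euc n) (x v : Euc n) : Euc n :=
  v - (inner ℝ x v : ℝ) • x - (inner ℝ (η x) v : ℝ) • η x

/-- The shape operator of `Γ` in the unit sphere, extended by zero to the normal space of `Γ`. -/
def sphShapeOp {n : ℕ} (η : Euc n → Euc n) (x v : Euc n) : Euc n :=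
  sphTanProj η x (-fderiv ℝ η x (sphTanProj η x v))

/-- The mean curvature of `Γ` in the unit sphere. -/
def sphMeanCurvature {n : ℕ} (η : Euc n → Euc n) (x : Euc n) : ℝ := coordTrace (sphShapeOp η x)

/-- `|A_Γ|²`, for the second fundamental form of `Γ` in the unit sphere. -/
def sphNormSqA {n : ℕ} (η : Euc n → Euc n) (x : Euc n) : ℝ :=
  coordTrace fun v => sphShapeOp η x (sphShapeOp η x v)

/-- The Laplace-Beltrami operator `Δ_Γ f = div_Γ (∇_Γ f)`. -/
def sphLaplacian {n : ℕ} (η : Euc n → Euc n) (f : Euc n → ℝ) (x : Euc n) : ℝ :=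
  coordTrace fun v =>
    sphTanProj η x (fderiv ℝ (fun y => sphTanProj η y (gradient f y)) x (sphTanProj η x v))

/-- `Γ`, with unit normal `η`, is a closed embedded minimal hypersurface of the unit sphere. -/
structure IsClosedMinimalInSphere {n : ℕ} (Γ : Set (Euc n)) (η : Euc n → Euc n) : Prop where
  nonempty : Γ.Nonempty
  isCompact : IsCompact Γ
  hypersurface : ∀ p ∈ Γ, ∃ T, IsSpherePoint Γ p T
  unit_normal : IsSphereUnitNormal Γ η
  minimal : ∀ p ∈ Γ, sphMeanCurvature η p = 0

/-- `μ` is an eigenvalue of the Jacobi operator `J_Γ f = -Δ_Γ f - |A_Γ|² f`. -/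
def IsJacobiEigenvalue {n : ℕ} (Γ : Set (Euc n)) (η : Euc n → Euc n) (μ : ℝ) : Prop :=
  ∃ f : Euc n → ℝ, ContDiff ℝ ∞ f ∧ (∃ p ∈ Γ, f p ≠ 0) ∧
    ∀ p ∈ Γ, -sphLaplacian η f p - sphNormSqA η p * f p = μ * f p

/-- The Clifford torus `𝕊^k(√(k/(n-2))) × 𝕊^{n-2-k}(√((n-2-k)/(n-2)))` in
`ℝ^{k+1} × ℝ^{n-1-k} = ℝⁿ`. -/
def cliffordTorus (n k : ℕ) : Set (Euc n) :=
  {x | ∑ i : Fin n, (if i.val < k + 1 then x i ^ 2 else 0) = (k : ℝ) / ((n : ℝ) - 2) ∧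
    ∑ i : Fin n, (if i.val < k + 1 then 0 else x i ^ 2) = ((n : ℝ) - 2 - k) / ((n : ℝ) - 2)}

/-- The truncated cone `Σ_Γ = {t y | t > 0, y ∈ Γ} ∩ {R₀ ≤ ‖x‖}`. -/
def truncatedCone {n : ℕ} (R₀ : ℝ) (Γ : Set (Euc n)) : Set (Euc n) :=
  {x | R₀ ≤ ‖x‖ ∧ ∃ t : ℝ, 0 < t ∧ ∃ y ∈ Γ, x = t • y}

end

/-!
The cone over the Clifford torus is the quadric cone `⟪x, D x⟫ = 0` of a symmetric operator `D` with
`D² = (α - α⁻¹) D + 1` and `tr D = α - α⁻¹`, and `D x / ‖x‖` is its Euclidean unit normal. The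
Schwarzschild metric is `f² δ` with `f` radial and the normal of a cone is tangent to the spheres
about the origin, so passing from `δ` to `f² δ` only multiplies the shape operator by `f⁻¹`: the
cone stays minimal, with `|A|² = (n - 2) / (r f)²`. On the link `|A|²` is the constant `n - 2`, so
constants are Jacobi functions with eigenvalue `-(n - 2)`, and the maximum principle shows that no
eigenvalue is smaller.

The horizon is totally geodesic, so the boundary term of the second variation vanishes. In the
interior term only the radial part of the gradient is kept. Polar coordinates then reduce stability
to a one-dimensional inequality along each ray, which follows by subtracting the derivative of
`-β τ (r f) ^ (n - 3) φ²`, where `τ = d log (r f) / d log r`, and completing the square. A suitable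
`β` exists for `n ≥ 8`.
-/

open scoped InnerProductSpace Topology ENNReal

section Trace

variable {n : ℕ}

lemma coordTrace_eq_trace (T : Euc n →ₗ[ℝ] Euc n) :
    coordTrace T = LinearMap.trace ℝ (Euc n) T := by
  rw [LinearMap.trace_eq_sum_inner T (EuclideanSpace.basisFun (Fin n) ℝ)]
  simp [coordTrace, stdVec, EuclideanSpace.inner_single_left]

lemma coordTrace_eq_sum_inner (T : Euc n → Euc n) :
    coordTrace T = ∑ i, ⟪stdVec i, T (stdVec i)⟫_ℝ := by
  simp [coordTrace, stdVec, EuclideanSpace.inner_single_left]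

lemma coordTrace_comp_comm (S T : Euc n →L[ℝ] Euc n) :
    coordTrace (fun v => S (T v)) = coordTrace (fun v => T (S v)) := by
  have htrace (S T : Euc n →L[ℝ] Euc n) : coordTrace (fun v => S (T v)) =
      LinearMap.trace ℝ (Euc n) ((S : Euc n →ₗ[ℝ] Euc n) ∘ₗ T) :=
    coordTrace_eq_trace ((S : Euc n →ₗ[ℝ] Euc n) ∘ₗ T)
  rw [htrace, htrace, LinearMap.trace_comp_comm']

lemma coordTrace_add (S T : Euc n → Euc n) :
    coordTrace (fun v => S v + T v) = coordTrace S + coordTrace T := by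
  simp [coordTrace, Finset.sum_add_distrib]

lemma coordTrace_sub (S T : Euc n → Euc n) :
    coordTrace (fun v => S v - T v) = coordTrace S - coordTrace T := by
  simp [coordTrace, Finset.sum_sub_distrib]

lemma coordTrace_smul (c : ℝ) (T : Euc n → Euc n) :
    coordTrace (fun v => c • T v) = c * coordTrace T := by
  simp [coordTrace, Finset.mul_sum]

lemma coordTrace_id : coordTrace (fun v : Euc n => v) = n := by
  simp [coordTrace, stdVec]

lemma coordTrace_rankOne (a b : Euc n) : coordTrace (fun v => ⟪a, v⟫_ℝ • b) = ⟪a, b⟫_ℝ := by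
  simp [coordTrace, stdVec, PiLp.inner_apply, mul_comm]

end Trace

section ConformalMetric

variable {n : ℕ} {f : Euc n → ℝ} {x : Euc n}

/-- The metric `f² δ` conformal to the Euclidean metric `δ`. -/
noncomputable def conformalMetric (f : Euc n → ℝ) : MetricField n := fun x v w => f x ^ 2 * ⟪v, w⟫_ℝ

lemma conformalMetric_self (v : Euc n) : conformalMetric f x v v = (f x * ‖v‖) ^ 2 := by
  rw [conformalMetric, real_inner_self_eq_norm_sq, mul_pow]

lemma conformalMetric_inv_smul_left (hf : f x ≠ 0) (v w : Euc n) :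
    conformalMetric f x ((f x)⁻¹ • v) w = f x * ⟪v, w⟫_ℝ := by
  rw [conformalMetric, real_inner_smul_left]
  field_simp

lemma conformalMetric_eq_zero_iff (hf : f x ≠ 0) {v w : Euc n} :
    conformalMetric f x v w = 0 ↔ ⟪v, w⟫_ℝ = 0 := by
  simp [conformalMetric, hf]

lemma raiseIndex_conformalMetric (hf : f x ≠ 0) (a : Euc n) :
    raiseIndex (conformalMetric f) x (fun z => ⟪a, z⟫_ℝ) = (f x ^ 2)⁻¹ • a := by
  have hg : gramMatrix (conformalMetric f) x = f x ^ 2 • (1 : Matrix (Fin n) (Fin n) ℝ) := by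
    ext i j
    simp [gramMatrix, conformalMetric, stdVec, Matrix.one_apply, EuclideanSpace.inner_single_left]
  have hinv : (gramMatrix (conformalMetric f) x)⁻¹ =
      (f x ^ 2)⁻¹ • (1 : Matrix (Fin n) (Fin n) ℝ) := by
    apply Matrix.inv_eq_right_inv
    rw [hg, smul_mul_smul_comm, mul_one, mul_inv_cancel₀ (pow_ne_zero 2 hf), one_smul]
  ext i
  rw [raiseIndex, hinv]
  simp [stdVec, Matrix.one_apply, EuclideanSpace.inner_single_right, Pi.single_apply]

lemma metricGradient_conformalMetric (hf : f x ≠ 0) (u : Euc n → ℝ) :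
    metricGradient (conformalMetric f) u x = (f x ^ 2)⁻¹ • gradient u x := by
  simp_rw [metricGradient, ← inner_gradient_left]
  exact raiseIndex_conformalMetric hf _

lemma christoffel_conformalMetric (hf : f x ≠ 0) (hf' : DifferentiableAt ℝ f x) (v w : Euc n) :
    christoffel (conformalMetric f) x v w =
      (f x)⁻¹ • (fderiv ℝ f x v • w + fderiv ℝ f x w • v - ⟪v, w⟫_ℝ • gradient f x) := by
  have hg (a b z : Euc n) : fderiv ℝ (fun y => conformalMetric f y a b) x z =
      2 * f x * fderiv ℝ f x z * ⟪a, b⟫_ℝ := by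
    rw [show (fun y => conformalMetric f y a b) = fun y => f y ^ 2 * ⟪a, b⟫_ℝ from rfl,
      ((hf'.hasFDerivAt.pow 2).mul_const _).fderiv]
    simp
    ring
  have hKoszul (z : Euc n) :
      (1 / 2 : ℝ) * (fderiv ℝ (fun y => conformalMetric f y w z) x v +
        fderiv ℝ (fun y => conformalMetric f y v z) x w -
        fderiv ℝ (fun y => conformalMetric f y v w) x z) =
      ⟪f x • (fderiv ℝ f x v • w + fderiv ℝ f x w • v - ⟪v, w⟫_ℝ • gradient f x), z⟫_ℝ := by
    simp only [hg, real_inner_smul_left, inner_add_left, inner_sub_left, inner_gradient_left]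
    ring
  rw [christoffel, funext hKoszul, raiseIndex_conformalMetric hf, smul_smul, pow_two, mul_inv,
    inv_mul_cancel_right₀ hf]

/-- The derivative of the factor `f⁻¹` cancels against the term `f⁻¹ df(v)` of the connection. -/
lemma covDeriv_conformalMetric_inv_smul {ν : Euc n → Euc n} (hf : f x ≠ 0)
    (hf' : DifferentiableAt ℝ f x) (hν : DifferentiableAt ℝ ν x) (v : Euc n) :
    covDeriv (conformalMetric f) (fun y => (f y)⁻¹ • ν y) x v =
      (f x)⁻¹ • (fderiv ℝ ν x v +
        (f x)⁻¹ • (fderiv ℝ f x (ν x) • v - ⟪v, ν x⟫_ℝ • gradient f x)) := by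
  have hinv : HasFDerivAt (fun y => (f y)⁻¹) (-(f x ^ 2)⁻¹ • fderiv ℝ f x) x :=
    (hasDerivAt_inv hf).comp_hasFDerivAt x hf'.hasFDerivAt
  rw [covDeriv, (hinv.fun_smul hν.hasFDerivAt).fderiv, christoffel_conformalMetric hf hf']
  simp only [add_apply, smul_apply, ContinuousLinearMap.smulRight_apply, map_smul, smul_eq_mul,
    real_inner_smul_right]
  module

lemma tanProj_conformalMetric_inv_smul (hf : f x ≠ 0) (ν : Euc n → Euc n) (v : Euc n) :
    tanProj (conformalMetric f) (fun y => (f y)⁻¹ • ν y) x v = v - ⟪ν x, v⟫_ℝ • ν x := by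
  rw [tanProj, conformalMetric_inv_smul_left hf, smul_smul, mul_right_comm, mul_inv_cancel₀ hf,
    one_mul]

lemma shapeOp_conformalMetric_inv_smul {ν : Euc n → Euc n} (hf : f x ≠ 0)
    (hf' : DifferentiableAt ℝ f x) (hν : DifferentiableAt ℝ ν x) (hν₁ : ‖ν x‖ = 1)
    (hfν : fderiv ℝ f x (ν x) = 0) (v : Euc n) :
    shapeOp (conformalMetric f) (fun y => (f y)⁻¹ • ν y) x v =
      -(f x)⁻¹ • (fderiv ℝ ν x (v - ⟪ν x, v⟫_ℝ • ν x) -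
        ⟪ν x, fderiv ℝ ν x (v - ⟪ν x, v⟫_ℝ • ν x)⟫_ℝ • ν x) := by
  have htan : ⟪v - ⟪ν x, v⟫_ℝ • ν x, ν x⟫_ℝ = 0 := by
    rw [inner_sub_left, real_inner_smul_left, real_inner_self_eq_norm_sq, hν₁, real_inner_comm]
    ring
  rw [shapeOp, tanProj_conformalMetric_inv_smul hf, tanProj_conformalMetric_inv_smul hf,
    covDeriv_conformalMetric_inv_smul hf hf' hν, hfν, htan]
  simp only [zero_smul, sub_zero, smul_zero, add_zero, inner_neg_right, real_inner_smul_right]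
  module

lemma IsTotallyGeodesic.shapeOp_eq_zero {S : Set (Euc n)} {ξ : Euc n → Euc n} (hf : f x ≠ 0)
    (h : IsTotallyGeodesic (conformalMetric f) S ξ) (hx : x ∈ S)
    (hξ : conformalMetric f x (ξ x) (ξ x) = 1) (v : Euc n) :
    shapeOp (conformalMetric f) ξ x v = 0 := by
  have htan (z : Euc n) : conformalMetric f x (ξ x) (tanProj (conformalMetric f) ξ x z) = 0 := by
    simp only [tanProj, conformalMetric, inner_sub_right, real_inner_smul_right] at hξ ⊢
    linear_combination -(f x ^ 2 * ⟪ξ x, z⟫_ℝ) * hξ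
  rw [shapeOp]
  set w := covDeriv (conformalMetric f) ξ x (tanProj (conformalMetric f) ξ x v)
  set z := tanProj (conformalMetric f) ξ x (-w)
  have hzw : ⟪w, z⟫_ℝ = 0 := by
    simpa only [secondFF, neg_eq_zero, conformalMetric_eq_zero_iff hf] using
      h x hx _ z (htan v) (htan (-w))
  have hzξ : ⟪ξ x, z⟫_ℝ = 0 := (conformalMetric_eq_zero_iff hf).mp (htan (-w))
  rw [← inner_self_eq_zero (𝕜 := ℝ)]
  calc ⟪z, z⟫_ℝ = ⟪-w - conformalMetric f x (ξ x) (-w) • ξ x, z⟫_ℝ := rfl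
    _ = 0 := by rw [inner_sub_left, real_inner_smul_left, inner_neg_left, hzw, hzξ]; simp

lemma sq_fderiv_le_normSqTanGrad_mul (hf : f x ≠ 0) {ξ : Euc n → Euc n} {w : Euc n}
    (hw : ⟪ξ x, w⟫_ℝ = 0) (u : Euc n → ℝ) :
    fderiv ℝ u x w ^ 2 ≤
      normSqTanGrad (conformalMetric f) ξ u x * conformalMetric f x w w := by
  set z := tanProj (conformalMetric f) ξ x (metricGradient (conformalMetric f) u x) with hz
  have hdu : fderiv ℝ u x w = f x ^ 2 * ⟪z, w⟫_ℝ := by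
    rw [hz, tanProj, inner_sub_left, real_inner_smul_left, hw, mul_zero, sub_zero,
      metricGradient_conformalMetric hf, real_inner_smul_left, inner_gradient_left,
      mul_inv_cancel_left₀ (pow_ne_zero 2 hf)]
  rw [hdu, normSqTanGrad, ← hz, conformalMetric_self, conformalMetric_self]
  calc (f x ^ 2 * ⟪z, w⟫_ℝ) ^ 2 = (f x ^ 2) ^ 2 * ⟪z, w⟫_ℝ ^ 2 := by ring
    _ ≤ (f x ^ 2) ^ 2 * (‖z‖ * ‖w‖) ^ 2 := by
      gcongr 1
      exact sq_le_sq' (neg_le_of_abs_le (abs_real_inner_le_norm z w)) (real_inner_le_norm z w)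
    _ = (f x * ‖z‖) ^ 2 * (f x * ‖w‖) ^ 2 := by ring

end ConformalMetric

section RadialConformalFactor

lemma hasFDerivAt_comp_norm {E : Type*} [NormedAddCommGroup E] [InnerProductSpace ℝ E]
    {F : ℝ → ℝ} {F' : ℝ} {x : E} (hx : x ≠ 0) (hF : HasDerivAt F F' ‖x‖) :
    HasFDerivAt (fun y : E => F ‖y‖) ((F' / ‖x‖) • innerSL ℝ x) x := by
  have hnorm : HasFDerivAt (fun y : E => ‖y‖) ((1 / ‖x‖) • innerSL ℝ x) x := by
    have hsq := (hasStrictFDerivAt_norm_sq x).hasFDerivAt.sqrt (by positivity)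
    simp only [Real.sqrt_sq (norm_nonneg _)] at hsq
    refine hsq.congr_fderiv ?_
    ext v
    simp
    field_simp
  exact (hF.comp_hasFDerivAt x hnorm).congr_fderiv (by rw [smul_smul, mul_one_div])

variable {n : ℕ} {f c : Euc n → ℝ} {c₁ : ℝ} {x : Euc n}

lemma christoffel_conformalMetric_radial (hf : f x ≠ 0)
    (hf' : HasFDerivAt f ((f x * c x) • innerSL ℝ x) x) (v w : Euc n) :
    christoffel (conformalMetric f) x v w =
      c x • (⟪x, v⟫_ℝ • w + ⟪x, w⟫_ℝ • v - ⟪v, w⟫_ℝ • x) := by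
  have hgrad : gradient f x = (f x * c x) • x := by
    refine ext_inner_right ℝ fun v => ?_
    rw [inner_gradient_left, hf'.fderiv, real_inner_smul_left]
    rfl
  rw [christoffel_conformalMetric hf hf'.differentiableAt, hgrad, hf'.fderiv]
  simp only [smul_apply, innerSL_apply_apply, smul_eq_mul]
  match_scalars <;> field_simp

lemma fderiv_christoffel_conformalMetric_radial
    (hf : ∀ᶠ y in 𝓝 x, f y ≠ 0 ∧ HasFDerivAt f ((f y * c y) • innerSL ℝ y) y)
    (hc : HasFDerivAt c (c₁ • innerSL ℝ x) x) (v w u : Euc n) :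
    fderiv ℝ (fun y => christoffel (conformalMetric f) y v w) x u =
      (c₁ * ⟪x, u⟫_ℝ) • (⟪x, v⟫_ℝ • w + ⟪x, w⟫_ℝ • v - ⟪v, w⟫_ℝ • x) +
      c x • (⟪u, v⟫_ℝ • w + ⟪u, w⟫_ℝ • v - ⟪v, w⟫_ℝ • u) := by
  have heq : (fun y => christoffel (conformalMetric f) y v w) =ᶠ[𝓝 x] fun y =>
      c y • (⟪v, y⟫_ℝ • w + ⟪w, y⟫_ℝ • v - ⟪v, w⟫_ℝ • y) := by
    filter_upwards [hf] with y hy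
    rw [christoffel_conformalMetric_radial hy.1 hy.2, real_inner_comm v, real_inner_comm w]
  have hlin : HasFDerivAt (fun y : Euc n => ⟪v, y⟫_ℝ • w + ⟪w, y⟫_ℝ • v - ⟪v, w⟫_ℝ • y)
      ((innerSL ℝ v).smulRight w + (innerSL ℝ w).smulRight v -
        ⟪v, w⟫_ℝ • ContinuousLinearMap.id ℝ (Euc n)) x :=
    (((innerSL ℝ v).hasFDerivAt.smul_const w).add ((innerSL ℝ w).hasFDerivAt.smul_const v)).sub
      ((hasFDerivAt_id x).fun_const_smul _)
  rw [heq.fderiv_eq, (hc.fun_smul hlin).fderiv, ← real_inner_comm v x, ← real_inner_comm w x,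
    real_inner_comm v u, real_inner_comm w u]
  simp only [add_apply, sub_apply, smul_apply, ContinuousLinearMap.smulRight_apply,
    innerSL_apply_apply, ContinuousLinearMap.id_apply, smul_eq_mul]
  module

lemma ricciCurvature_conformalMetric_radial
    (hf : ∀ᶠ y in 𝓝 x, f y ≠ 0 ∧ HasFDerivAt f ((f y * c y) • innerSL ℝ y) y)
    (hc : HasFDerivAt c (c₁ • innerSL ℝ x) x) {v : Euc n} (hv : ⟪x, v⟫_ℝ = 0) :
    ricciCurvature (conformalMetric f) x v v =
      -(c₁ * ‖x‖ ^ 2 + 2 * ((n : ℝ) - 1) * c x + ((n : ℝ) - 2) * c x ^ 2 * ‖x‖ ^ 2) *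
        ‖v‖ ^ 2 := by
  have hvx : ⟪v, x⟫_ℝ = 0 := by rw [real_inner_comm, hv]
  have hR (u : Euc n) : curvatureTensor (conformalMetric f) x u v v =
      (-(c₁ * ‖v‖ ^ 2) + c x ^ 2 * ‖v‖ ^ 2) • ⟪x, u⟫_ℝ • x +
      (2 * c x + c x ^ 2 * ‖x‖ ^ 2) • ⟪v, u⟫_ℝ • v -
      (2 * c x * ‖v‖ ^ 2 + c x ^ 2 * ‖v‖ ^ 2 * ‖x‖ ^ 2) • u := by
    have hΓ := christoffel_conformalMetric_radial hf.self_of_nhds.1 hf.self_of_nhds.2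
    rw [curvatureTensor, fderiv_christoffel_conformalMetric_radial hf hc,
      fderiv_christoffel_conformalMetric_radial hf hc]
    simp only [hΓ, hv, hvx, inner_smul_right, inner_sub_right, inner_add_right,
      real_inner_self_eq_norm_sq, real_inner_comm v u, real_inner_comm x u]
    module
  rw [ricciCurvature, funext hR, coordTrace_sub, coordTrace_add]
  rw [coordTrace_smul _ fun v => v, coordTrace_id]
  simp only [coordTrace_smul, coordTrace_rankOne, real_inner_self_eq_norm_sq]
  ring

end RadialConformalFactor

section SchwarzschildProfile

variable {n : ℕ} {m r : ℝ}

/-- The conformal factor `f` of the Schwarzschild metric as a function of the radius. -/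
noncomputable def schwProfile (n : ℕ) (m r : ℝ) : ℝ :=
  (1 + m / (2 * r ^ (n - 2))) ^ (2 / ((n : ℝ) - 2))

/-- The logarithmic derivative `τ = d log (r f) / d log r`. The principal curvatures of the sphere
of radius `r` are `τ / (r f)`, so that the horizon is the zero of `τ`. -/
noncomputable def schwTau (n : ℕ) (m r : ℝ) : ℝ := (2 * r ^ (n - 2) - m) / (2 * r ^ (n - 2) + m)

/-- The coefficient `c = (τ - 1) / r²` in `df_x = f c ⟪x, ·⟫`, on which the Christoffel symbols
depend. -/
noncomputable def schwCoeff (n : ℕ) (m r : ℝ) : ℝ := (schwTau n m r - 1) / r ^ 2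

lemma schwProfile_pos (hm : 0 < m) (hr : 0 < r) : 0 < schwProfile n m r := by
  unfold schwProfile; positivity

lemma schwTau_sq_le_one (hm : 0 < m) (hr : 0 < r) : schwTau n m r ^ 2 ≤ 1 := by
  have hp : 0 < r ^ (n - 2) := pow_pos hr _
  rw [schwTau, sq_le_one_iff_abs_le_one, abs_div, div_le_one (by positivity),
    abs_of_pos (by positivity : 0 < 2 * r ^ (n - 2) + m), abs_le]
  constructor <;> linarith

lemma horizonRadius_pos (n : ℕ) (hm : 0 < m) : 0 < horizonRadius n m := by
  unfold horizonRadius; positivity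

lemma horizonRadius_pow (hn : 2 < n) (hm : 0 < m) : horizonRadius n m ^ (n - 2) = m / 2 := by
  have hn₂ : ((n - 2 : ℕ) : ℝ) = n - 2 := by rw [Nat.cast_sub hn.le, Nat.cast_ofNat]
  rw [horizonRadius, ← hn₂, one_div, Real.rpow_inv_natCast_pow (by positivity) (by omega)]

lemma schwTau_horizonRadius (hn : 2 < n) (hm : 0 < m) : schwTau n m (horizonRadius n m) = 0 := by
  rw [schwTau, horizonRadius_pow hn hm, mul_div_cancel₀ m two_ne_zero, sub_self, zero_div]

lemma hasDerivAt_pow_sub_two (hn : 2 < n) (hr : 0 < r) :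
    HasDerivAt (fun s : ℝ => s ^ (n - 2)) (((n : ℝ) - 2) * r ^ (n - 2) / r) r := by
  obtain ⟨k, rfl⟩ : ∃ k, n = k + 3 := ⟨n - 3, by omega⟩
  refine (hasDerivAt_pow (k + 1) r).congr_deriv ?_
  rw [Nat.add_sub_cancel]
  push_cast
  field_simp
  ring

lemma hasDerivAt_schwProfile (hn : 2 < n) (hm : 0 < m) (hr : 0 < r) :
    HasDerivAt (schwProfile n m) (schwProfile n m r * (schwTau n m r - 1) / r) r := by
  have hn₂ : (0 : ℝ) < n - 2 := sub_pos.mpr (by exact_mod_cast hn)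
  have hbase : HasDerivAt (fun s : ℝ => 1 + m / (2 * s ^ (n - 2)))
      (-(((n : ℝ) - 2) * m / (2 * r ^ (n - 2)) / r)) r := by
    refine ((((hasDerivAt_pow_sub_two hn hr).const_mul 2).fun_inv (by positivity)).const_mul
      m |>.const_add 1).congr_deriv ?_
    field_simp
  have hbase_pos : 0 < 1 + m / (2 * r ^ (n - 2)) := by positivity
  refine (hbase.rpow_const (p := 2 / ((n : ℝ) - 2)) (Or.inl hbase_pos.ne')).congr_deriv ?_
  rw [schwProfile, schwTau, Real.rpow_sub_one hbase_pos.ne']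
  generalize (1 + m / (2 * r ^ (n - 2))) ^ (2 / ((n : ℝ) - 2)) = F
  field_simp
  ring

lemma hasDerivAt_schwTau (hn : 2 < n) (hm : 0 < m) (hr : 0 < r) :
    HasDerivAt (schwTau n m) (((n : ℝ) - 2) / 2 * (1 - schwTau n m r ^ 2) / r) r := by
  have hP := (hasDerivAt_pow_sub_two hn hr).const_mul 2
  refine ((hP.sub_const m).fun_div (hP.add_const m) (by positivity)).congr_deriv ?_
  unfold schwTau
  field_simp
  ring

lemma hasDerivAt_schwCoeff (hn : 2 < n) (hm : 0 < m) (hr : 0 < r) :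
    HasDerivAt (schwCoeff n m)
      ((((n : ℝ) - 2) / 2 * (1 - schwTau n m r ^ 2) - 2 * (schwTau n m r - 1)) / r ^ 3) r := by
  refine (((hasDerivAt_schwTau hn hm hr).sub_const 1).fun_div (hasDerivAt_pow 2 r)
    (by positivity)).congr_deriv ?_
  field_simp
  ring

end SchwarzschildProfile

section SchwarzschildMetric

variable {n : ℕ} {m : ℝ} {x : Euc n}

lemma schwFactor_pos (hm : 0 < m) (hx : x ≠ 0) : 0 < schwFactor n m x :=
  schwProfile_pos hm (norm_pos_iff.mpr hx)

lemma hasFDerivAt_schwFactor (hn : 2 < n) (hm : 0 < m) (hx : x ≠ 0) :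
    HasFDerivAt (schwFactor n m)
      ((schwFactor n m x * schwCoeff n m ‖x‖) • innerSL ℝ x) x := by
  refine (hasFDerivAt_comp_norm hx
    (hasDerivAt_schwProfile hn hm (norm_pos_iff.mpr hx))).congr_fderiv ?_
  rw [schwCoeff, show schwFactor n m x = schwProfile n m ‖x‖ from rfl]
  congr 1
  field_simp

lemma ricciCurvature_schwMetric (hn : 2 < n) (hm : 0 < m) (hx : x ≠ 0) {v : Euc n}
    (hv : ⟪x, v⟫_ℝ = 0) :
    ricciCurvature (schwMetric n m) x v v =
      ((n : ℝ) - 2) / 2 * (1 - schwTau n m ‖x‖ ^ 2) / ‖x‖ ^ 2 * ‖v‖ ^ 2 := by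
  have hf : ∀ᶠ y in 𝓝 x, schwFactor n m y ≠ 0 ∧
      HasFDerivAt (schwFactor n m) ((schwFactor n m y * schwCoeff n m ‖y‖) • innerSL ℝ y) y := by
    filter_upwards [isOpen_ne.mem_nhds hx] with y hy
    exact ⟨(schwFactor_pos hm hy).ne', hasFDerivAt_schwFactor hn hm hy⟩
  have hc := hasFDerivAt_comp_norm hx (hasDerivAt_schwCoeff hn hm (norm_pos_iff.mpr hx))
  refine (ricciCurvature_conformalMetric_radial (c := (schwCoeff n m ‖·‖)) hf hc hv).trans ?_
  have hr := norm_ne_zero_iff.mpr hx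
  rw [schwCoeff]
  field_simp
  ring

lemma hasFDerivAt_inv_norm_smul {E F : Type*} [NormedAddCommGroup E] [InnerProductSpace ℝ E]
    [NormedAddCommGroup F] [NormedSpace ℝ F] (D : E →L[ℝ] F) {x : E} (hx : x ≠ 0) :
    HasFDerivAt (fun y => ‖y‖⁻¹ • D y)
      (‖x‖⁻¹ • (D - (‖x‖ ^ 2)⁻¹ • (innerSL ℝ x).smulRight (D x))) x := by
  have hr := norm_ne_zero_iff.mpr hx
  refine ((hasFDerivAt_comp_norm hx (hasDerivAt_inv hr)).fun_smul D.hasFDerivAt).congr_fderiv ?_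
  ext v
  simp only [add_apply, smul_apply, sub_apply, ContinuousLinearMap.smulRight_apply,
    innerSL_apply_apply, smul_eq_mul]
  match_scalars <;> field_simp

lemma secondFF_radialNormal (hn : 2 < n) (hm : 0 < m) (hx : x ≠ 0) {v : Euc n}
    (hv : ⟪x, v⟫_ℝ = 0) (w : Euc n) :
    secondFF (schwMetric n m) (radialNormal n m) x v w =
      -(schwFactor n m x * schwTau n m ‖x‖ / ‖x‖ * ⟪v, w⟫_ℝ) := by
  have hr := norm_ne_zero_iff.mpr hx
  have hf := (schwFactor_pos hm hx).ne'
  have hf' := hasFDerivAt_schwFactor hn hm hx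
  have hν := hasFDerivAt_inv_norm_smul (ContinuousLinearMap.id ℝ (Euc n)) hx
  have hrad : radialNormal n m =
      fun y => (schwFactor n m y)⁻¹ • ‖y‖⁻¹ • ContinuousLinearMap.id ℝ (Euc n) y := by
    ext1 y
    rw [radialNormal, mul_inv, mul_smul, ContinuousLinearMap.id_apply]
  have hcov : covDeriv (schwMetric n m) (radialNormal n m) x v =
      (schwFactor n m x)⁻¹ • (schwTau n m ‖x‖ / ‖x‖) • v := by
    rw [hrad]
    refine (covDeriv_conformalMetric_inv_smul hf hf'.differentiableAt
      hν.differentiableAt v).trans ?_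
    rw [hν.fderiv, hf'.fderiv]
    simp only [smul_apply, sub_apply, ContinuousLinearMap.smulRight_apply, innerSL_apply_apply,
      ContinuousLinearMap.id_apply, real_inner_smul_right, real_inner_comm x v, hv, smul_eq_mul,
      real_inner_self_eq_norm_sq, schwCoeff]
    match_scalars <;> field_simp <;> ring
  rw [secondFF, hcov]
  exact congrArg Neg.neg ((conformalMetric_inv_smul_left hf _ _).trans
    (by rw [real_inner_smul_left]; ring))

end SchwarzschildMetric

section CliffordOperator

variable {n : ℕ} {D : Euc n →L[ℝ] Euc n} {α : ℝ} {x : Euc n}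

/-- `D` is symmetric with eigenvalues `α > 0` and `-α⁻¹`, and its trace is `α - α⁻¹`. The cone
`⟪x, D x⟫ = 0` is then the cone over a Clifford torus. -/
structure IsCliffordOp (D : Euc n →L[ℝ] Euc n) (α : ℝ) : Prop where
  pos : 0 < α
  symm : ∀ x y, ⟪D x, y⟫_ℝ = ⟪x, D y⟫_ℝ
  sq : ∀ x, D (D x) = (α - α⁻¹) • D x + x
  trace : coordTrace D = α - α⁻¹

/-- The orthogonal projection onto the orthogonal complement of `x` and `D x`, which for a point
`x ≠ 0` of the cone `⟪x, D x⟫ = 0` is the tangent space of the link of the cone. -/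
noncomputable def linkTangentProj (D : Euc n →L[ℝ] Euc n) (x : Euc n) : Euc n →L[ℝ] Euc n :=
  ContinuousLinearMap.id ℝ (Euc n) - (‖x‖ ^ 2)⁻¹ • (innerSL ℝ x).smulRight x -
    (‖x‖ ^ 2)⁻¹ • (innerSL ℝ (D x)).smulRight (D x)

lemma linkTangentProj_apply (D : Euc n →L[ℝ] Euc n) (x v : Euc n) :
    linkTangentProj D x v =
      v - (‖x‖ ^ 2)⁻¹ • ⟪x, v⟫_ℝ • x - (‖x‖ ^ 2)⁻¹ • ⟪D x, v⟫_ℝ • D x :=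
  rfl

lemma linkTangentProj_eq_self {v : Euc n} (hx : ⟪x, v⟫_ℝ = 0) (hDx : ⟪D x, v⟫_ℝ = 0) :
    linkTangentProj D x v = v := by
  simp [linkTangentProj_apply, hx, hDx]

lemma isSymmetric_linkTangentProj (D : Euc n →L[ℝ] Euc n) (x : Euc n) :
    (linkTangentProj D x : Euc n →ₗ[ℝ] Euc n).IsSymmetric := fun v w => by
  simp only [ContinuousLinearMap.coe_coe, linkTangentProj_apply, inner_sub_left, inner_sub_right,
    real_inner_smul_left, real_inner_smul_right, real_inner_comm v]
  ring

namespace IsCliffordOp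

lemma neg (h : IsCliffordOp D α) : IsCliffordOp (-D) α⁻¹ where
  pos := inv_pos.mpr h.pos
  symm x y := by simp [h.symm]
  sq x := by simp [h.sq]; module
  trace := by
    have hneg := coordTrace_smul (-1) D
    simp only [neg_smul, one_smul, neg_mul, one_mul, h.trace] at hneg
    rw [inv_inv, ← neg_sub, ← hneg]
    rfl

lemma inner_map_map (h : IsCliffordOp D α) (x v : Euc n) :
    ⟪D x, D v⟫_ℝ = (α - α⁻¹) * ⟪D x, v⟫_ℝ + ⟪x, v⟫_ℝ := by
  rw [← h.symm, h.sq, inner_add_left, real_inner_smul_left]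

lemma norm_map (h : IsCliffordOp D α) (hx : ⟪x, D x⟫_ℝ = 0) : ‖D x‖ = ‖x‖ := by
  rw [← sq_eq_sq₀ (norm_nonneg _) (norm_nonneg _), ← real_inner_self_eq_norm_sq, h.inner_map_map,
    h.symm, hx, real_inner_self_eq_norm_sq, mul_zero, zero_add]

lemma fderiv_inner_self_map (h : IsCliffordOp D α) (x v : Euc n) :
    fderiv ℝ (fun y => ⟪y, D y⟫_ℝ) x v = 2 * ⟪D x, v⟫_ℝ := by
  have hq : HasFDerivAt (fun y => ⟪y, D y⟫_ℝ) _ x := (hasFDerivAt_id x).inner ℝ D.hasFDerivAt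
  rw [hq.fderiv]
  simp [← h.symm, real_inner_comm v]
  ring

lemma inner_linkTangentProj (hx₀ : x ≠ 0) (hx : ⟪x, D x⟫_ℝ = 0) (v : Euc n) :
    ⟪x, linkTangentProj D x v⟫_ℝ = 0 := by
  have hr := norm_ne_zero_iff.mpr hx₀
  rw [linkTangentProj_apply]
  simp only [inner_sub_right, real_inner_smul_right, hx, real_inner_self_eq_norm_sq]
  field_simp
  ring

lemma inner_map_linkTangentProj (h : IsCliffordOp D α) (hx₀ : x ≠ 0) (hx : ⟪x, D x⟫_ℝ = 0)
    (v : Euc n) : ⟪D x, linkTangentProj D x v⟫_ℝ = 0 := by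
  have hr := norm_ne_zero_iff.mpr hx₀
  rw [linkTangentProj_apply]
  simp only [inner_sub_right, real_inner_smul_right, real_inner_comm x (D x), hx,
    real_inner_self_eq_norm_sq, h.norm_map hx]
  field_simp
  ring

lemma linkTangentProj_idem (h : IsCliffordOp D α) (hx₀ : x ≠ 0) (hx : ⟪x, D x⟫_ℝ = 0)
    (v : Euc n) : linkTangentProj D x (linkTangentProj D x v) = linkTangentProj D x v :=
  linkTangentProj_eq_self (inner_linkTangentProj hx₀ hx v) (h.inner_map_linkTangentProj hx₀ hx v)

lemma linkTangentProj_map (h : IsCliffordOp D α) (x v : Euc n) :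
    linkTangentProj D x (D v) = D (linkTangentProj D x v) := by
  simp only [linkTangentProj_apply, map_sub, map_smul, h.sq, h.inner_map_map, ← h.symm x v]
  module

lemma coordTrace_linkTangentProj (h : IsCliffordOp D α) (hx₀ : x ≠ 0) (hx : ⟪x, D x⟫_ℝ = 0) :
    coordTrace (linkTangentProj D x) = (n : ℝ) - 2 := by
  have hr := norm_ne_zero_iff.mpr hx₀
  rw [funext (linkTangentProj_apply D x), coordTrace_sub, coordTrace_sub, coordTrace_id,
    coordTrace_smul, coordTrace_smul, coordTrace_rankOne, coordTrace_rankOne,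
    real_inner_self_eq_norm_sq, real_inner_self_eq_norm_sq, h.norm_map hx]
  field_simp
  ring

lemma coordTrace_map_linkTangentProj (h : IsCliffordOp D α) (hx₀ : x ≠ 0)
    (hx : ⟪x, D x⟫_ℝ = 0) : coordTrace (fun v => D (linkTangentProj D x v)) = 0 := by
  have hr := norm_ne_zero_iff.mpr hx₀
  simp only [linkTangentProj_apply, map_sub, map_smul]
  rw [coordTrace_sub, coordTrace_sub, coordTrace_smul, coordTrace_smul, coordTrace_rankOne,
    coordTrace_rankOne, h.trace, hx, h.inner_map_map, real_inner_self_eq_norm_sq,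
    h.norm_map hx, hx]
  field_simp
  ring

lemma coordTrace_sq_map_linkTangentProj (h : IsCliffordOp D α) (hx₀ : x ≠ 0)
    (hx : ⟪x, D x⟫_ℝ = 0) :
    coordTrace (fun v => D (linkTangentProj D x (D (linkTangentProj D x v)))) = (n : ℝ) - 2 := by
  simp_rw [h.linkTangentProj_map, h.linkTangentProj_idem hx₀ hx, h.sq]
  rw [coordTrace_add, coordTrace_smul, h.coordTrace_map_linkTangentProj hx₀ hx,
    h.coordTrace_linkTangentProj hx₀ hx, mul_zero, zero_add]

end IsCliffordOp

end CliffordOperator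

section MinimalLink

variable {n : ℕ} {D : Euc n →L[ℝ] Euc n} {α : ℝ} {x : Euc n}

/-- The link `{‖x‖ = 1, ⟪x, D x⟫ = 0}` of the cone defined by `D`. -/
def quadricLink (D : Euc n →L[ℝ] Euc n) : Set (Euc n) := {x | ‖x‖ = 1 ∧ ⟪x, D x⟫_ℝ = 0}

lemma ne_zero_of_mem_quadricLink (hx : x ∈ quadricLink D) : x ≠ 0 :=
  norm_ne_zero_iff.mp (hx.1.trans_ne one_ne_zero)

lemma sphTanProj_eq_linkTangentProj (D : Euc n →L[ℝ] Euc n) (hx : ‖x‖ = 1) :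
    sphTanProj D x = linkTangentProj D x := by
  ext1 v
  rw [sphTanProj, linkTangentProj_apply, hx, one_pow, inv_one, one_smul, one_smul]

lemma contDiff_inner_self_map (D : Euc n →L[ℝ] Euc n) : ContDiff ℝ ∞ (fun y => ⟪y, D y⟫_ℝ) :=
  contDiff_id.inner ℝ D.contDiff

lemma isCompact_quadricLink (D : Euc n →L[ℝ] Euc n) : IsCompact (quadricLink D) := by
  refine (isCompact_sphere (0 : Euc n) 1).of_isClosed_subset ?_ fun x hx => by simpa using hx.1
  exact (isClosed_eq continuous_norm continuous_const).inter
    (isClosed_eq (contDiff_inner_self_map D).continuous continuous_const)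

namespace IsCliffordOp

lemma sphShapeOp_quadricLink (h : IsCliffordOp D α) (hx : x ∈ quadricLink D) (v : Euc n) :
    sphShapeOp D x v = -D (linkTangentProj D x v) := by
  rw [sphShapeOp, D.hasFDerivAt.fderiv, sphTanProj_eq_linkTangentProj D hx.1, ← map_neg,
    h.linkTangentProj_map, map_neg,
    h.linkTangentProj_idem (ne_zero_of_mem_quadricLink hx) hx.2, map_neg]

lemma sphMeanCurvature_quadricLink (h : IsCliffordOp D α) (hx : x ∈ quadricLink D) :
    sphMeanCurvature D x = 0 := by
  simp_rw [sphMeanCurvature, funext (h.sphShapeOp_quadricLink hx),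
    ← neg_one_smul ℝ (D (linkTangentProj D x _))]
  rw [coordTrace_smul,
    h.coordTrace_map_linkTangentProj (ne_zero_of_mem_quadricLink hx) hx.2, mul_zero]

lemma sphNormSqA_quadricLink (h : IsCliffordOp D α) (hx : x ∈ quadricLink D) :
    sphNormSqA D x = (n : ℝ) - 2 := by
  simp_rw [sphNormSqA, h.sphShapeOp_quadricLink hx, map_neg, neg_neg]
  exact h.coordTrace_sq_map_linkTangentProj (ne_zero_of_mem_quadricLink hx) hx.2

lemma isSpherePoint_quadricLink (h : IsCliffordOp D α) (hx : x ∈ quadricLink D) :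
    IsSpherePoint (quadricLink D) x {v | ⟪x, v⟫_ℝ = 0 ∧ ⟪D x, v⟫_ℝ = 0} := by
  refine ⟨Set.univ, fun y => ⟪y, D y⟫_ℝ, isOpen_univ, trivial,
    (contDiff_inner_self_map D).contDiffOn, ⟨D x, hx.2, ?_⟩, ?_, ?_⟩
  · rw [h.fderiv_inner_self_map, real_inner_self_eq_norm_sq, h.norm_map hx.2, hx.1]
    norm_num
  · ext y; simp [quadricLink]
  · ext v; simp [h.fderiv_inner_self_map]

lemma isClosedMinimalInSphere_quadricLink (h : IsCliffordOp D α)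
    (hne : (quadricLink D).Nonempty) : IsClosedMinimalInSphere (quadricLink D) D where
  nonempty := hne
  isCompact := isCompact_quadricLink D
  hypersurface _ hp := ⟨_, h.isSpherePoint_quadricLink hp⟩
  unit_normal :=
    { smooth := ⟨Set.univ, isOpen_univ, Set.subset_univ _, D.contDiff.contDiffOn⟩
      unit := fun _ hp => (h.norm_map hp.2).trans hp.1
      tangent_sphere := fun _ hp => hp.2
      normal := fun _ hp => ⟨_, h.isSpherePoint_quadricLink hp, fun _ hv => hv.2⟩ }
  minimal _ hp := h.sphMeanCurvature_quadricLink hp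

end IsCliffordOp

end MinimalLink

section SecondOrderMaximum

lemma hasDerivAt_deriv_nonpos_of_isLocalMax {g g' : ℝ → ℝ} {a c : ℝ}
    (hg : ∀ t, HasDerivAt g (g' t) t) (hg' : HasDerivAt g' c a) (hmax : IsLocalMax g a) :
    c ≤ 0 := by
  by_contra! hc
  have hderiv : deriv g = g' := funext fun t => (hg t).deriv
  have hmin : IsLocalMin g a := by
    refine isLocalMin_of_deriv_deriv_pos ?_ hmax.deriv_eq_zero (hg a).continuousAt
    rwa [hderiv, hg'.deriv]
  have hconst : g =ᶠ[𝓝 a] fun _ => g a := by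
    filter_upwards [hmax, hmin] with t h₁ h₂ using le_antisymm h₁ h₂
  have hg'₀ : g' =ᶠ[𝓝 a] fun _ => 0 := by
    simpa only [hderiv, deriv_const'] using hconst.deriv
  exact hc.ne' (hg'.unique ((hasDerivAt_const a (0 : ℝ)).congr_of_eventuallyEq hg'₀))

variable {E : Type*} [NormedAddCommGroup E] [InnerProductSpace ℝ E] [CompleteSpace E]
  {f : E → ℝ}

lemma differentiable_gradient (hf : ContDiff ℝ 2 f) : Differentiable ℝ (gradient f) :=
  (InnerProductSpace.toDual ℝ E).symm.toContinuousLinearEquiv.differentiable.comp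
    ((hf.fderiv_right (m := 1) (by norm_num)).differentiable one_ne_zero)

lemma inner_fderiv_gradient_add_nonpos {γ γ' : ℝ → E} {γ'' : E} {a : ℝ} (hf : ContDiff ℝ 2 f)
    (hγ : ∀ t, HasDerivAt γ (γ' t) t) (hγ' : HasDerivAt γ' γ'' a)
    (hmax : ∀ t, f (γ t) ≤ f (γ a)) :
    ⟪fderiv ℝ (gradient f) (γ a) (γ' a), γ' a⟫_ℝ + ⟪gradient f (γ a), γ''⟫_ℝ ≤ 0 := by
  have hfirst (t : ℝ) : HasDerivAt (fun s => f (γ s)) ⟪gradient f (γ t), γ' t⟫_ℝ t := by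
    rw [inner_gradient_left]
    exact ((hf.differentiable two_ne_zero) (γ t)).hasFDerivAt.comp_hasDerivAt t (hγ t)
  have hgrad : HasDerivAt (fun t => gradient f (γ t)) (fderiv ℝ (gradient f) (γ a) (γ' a)) a :=
    (differentiable_gradient hf (γ a)).hasFDerivAt.comp_hasDerivAt a (hγ a)
  rw [add_comm]
  exact hasDerivAt_deriv_nonpos_of_isLocalMax hfirst (hgrad.inner ℝ hγ') (.of_forall hmax)

lemma inner_fderiv_gradient_le_of_ellipse {a b w : E} (hf : ContDiff ℝ 2 f)
    (hmax : ∀ t, f (Real.cos t • a + Real.sin t • w + b) ≤ f (a + b)) :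
    ⟪fderiv ℝ (gradient f) (a + b) w, w⟫_ℝ ≤ ⟪gradient f (a + b), a⟫_ℝ := by
  have hγ (t : ℝ) : HasDerivAt (fun t => Real.cos t • a + Real.sin t • w + b)
      (-Real.sin t • a + Real.cos t • w) t :=
    (((Real.hasDerivAt_cos t).smul_const a).add ((Real.hasDerivAt_sin t).smul_const w)).add_const b
  have hγ' : HasDerivAt (fun t => -Real.sin t • a + Real.cos t • w) (-a) 0 :=
    (((Real.hasDerivAt_sin 0).fun_neg.smul_const a).add
      ((Real.hasDerivAt_cos 0).smul_const w)).congr_deriv (by simp)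
  have := inner_fderiv_gradient_add_nonpos hf hγ hγ' (by simpa using hmax)
  simpa using this

end SecondOrderMaximum

section TraceBound

variable {n : ℕ}

lemma coordTrace_comp_le_of_isSymmetricProjection {H A : Euc n →L[ℝ] Euc n} {c : ℝ}
    (hA : (A : Euc n →ₗ[ℝ] Euc n).IsSymmetricProjection)
    (hH : ∀ v, A v = v → ⟪H v, v⟫_ℝ ≤ c * ‖v‖ ^ 2) :
    coordTrace (fun v => H (A v)) ≤ c * coordTrace A := by
  have hidem (v : Euc n) : A (A v) = A v := DFunLike.congr_fun hA.isIdempotentElem.eq v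
  have hsymm (v w : Euc n) : ⟪A v, w⟫_ℝ = ⟪v, A w⟫_ℝ := hA.isSymmetric v w
  have htrace : coordTrace (fun v => H (A v)) = coordTrace (fun v => A (H (A v))) := by
    simpa [hidem] using coordTrace_comp_comm (H.comp A) A
  calc coordTrace (fun v => H (A v))
      = ∑ i, ⟪stdVec i, A (H (A (stdVec i)))⟫_ℝ := by rw [htrace, coordTrace_eq_sum_inner]
    _ = ∑ i, ⟪H (A (stdVec i)), A (stdVec i)⟫_ℝ := by simp only [← hsymm, real_inner_comm]
    _ ≤ ∑ i, c * ‖A (stdVec i)‖ ^ 2 := Finset.sum_le_sum fun i _ => hH _ (hidem _)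
    _ = ∑ i, c * ⟪stdVec i, A (stdVec i)⟫_ℝ := by
        simp only [← real_inner_self_eq_norm_sq, hsymm, hidem]
    _ = c * coordTrace A := by rw [← Finset.mul_sum, coordTrace_eq_sum_inner]

end TraceBound

section JacobiSpectrum

variable {n : ℕ} {D : Euc n →L[ℝ] Euc n} {α : ℝ} {x : Euc n}

lemma linkTangentProj_neg (D : Euc n →L[ℝ] Euc n) (x : Euc n) :
    linkTangentProj (-D) x = linkTangentProj D x := by
  ext1 v
  simp [linkTangentProj_apply]

lemma quadricLink_neg (D : Euc n →L[ℝ] Euc n) : quadricLink (-D) = quadricLink D := by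
  simp [quadricLink]

/-- The orthogonal projection onto the eigenspace of the eigenvalue `α` of an operator with
`IsCliffordOp D α`; since `IsCliffordOp (-D) α⁻¹`, the complementary projection is
`eigenProj (-D) α⁻¹`. -/
noncomputable def eigenProj (D : Euc n →L[ℝ] Euc n) (α : ℝ) : Euc n →L[ℝ] Euc n :=
  (α + α⁻¹)⁻¹ • (D + α⁻¹ • ContinuousLinearMap.id ℝ (Euc n))

lemma eigenProj_apply (D : Euc n →L[ℝ] Euc n) (α : ℝ) (x : Euc n) :
    eigenProj D α x = (α + α⁻¹)⁻¹ • (D x + α⁻¹ • x) :=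
  rfl

namespace IsCliffordOp

lemma map_eigenProj (h : IsCliffordOp D α) (x : Euc n) :
    D (eigenProj D α x) = α • eigenProj D α x := by
  have hα := h.pos
  simp only [eigenProj_apply, map_smul, map_add, h.sq]
  match_scalars
  · field_simp; ring
  · field_simp

lemma eigenProj_of_map_eq (h : IsCliffordOp D α) (hx : D x = α • x) : eigenProj D α x = x := by
  have hα := h.pos
  rw [eigenProj_apply, hx, ← add_smul, inv_smul_smul₀ (by positivity)]

lemma eigenProj_add_eigenProj_neg (h : IsCliffordOp D α) (x : Euc n) :
    eigenProj D α x + eigenProj (-D) α⁻¹ x = x := by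
  have hα := h.pos
  simp only [eigenProj_apply, _root_.neg_apply, inv_inv]
  match_scalars <;> field_simp <;> ring

lemma inner_eigenProj (h : IsCliffordOp D α) (x y : Euc n) :
    ⟪eigenProj D α x, y⟫_ℝ = ⟪x, eigenProj D α y⟫_ℝ := by
  simp only [eigenProj_apply, real_inner_smul_left, real_inner_smul_right, inner_add_left,
    inner_add_right, h.symm]

lemma norm_sq_eigenProj (h : IsCliffordOp D α) (hx : x ∈ quadricLink D) :
    ‖eigenProj D α x‖ ^ 2 = (α + α⁻¹)⁻¹ * α⁻¹ := by
  rw [← real_inner_self_eq_norm_sq, h.inner_eigenProj,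
    h.eigenProj_of_map_eq (h.map_eigenProj x), eigenProj_apply, real_inner_smul_right,
    inner_add_right, hx.2, real_inner_smul_right, real_inner_self_eq_norm_sq, hx.1]
  ring

lemma inner_eq_zero_of_eigenvectors (h : IsCliffordOp D α) {y z : Euc n} (hy : D y = α • y)
    (hz : D z = -α⁻¹ • z) : ⟪y, z⟫_ℝ = 0 := by
  have hα := h.pos
  have hsymm := h.symm y z
  rw [hy, hz, real_inner_smul_left, real_inner_smul_right] at hsymm
  have : (α + α⁻¹) * ⟪y, z⟫_ℝ = 0 := by linarith
  exact (mul_eq_zero.mp this).resolve_left (by positivity)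

lemma add_mem_quadricLink_iff (h : IsCliffordOp D α) {y z : Euc n} (hy : D y = α • y)
    (hz : D z = -α⁻¹ • z) :
    y + z ∈ quadricLink D ↔ ‖y‖ ^ 2 + ‖z‖ ^ 2 = 1 ∧ α * ‖y‖ ^ 2 - α⁻¹ * ‖z‖ ^ 2 = 0 := by
  have hyz := h.inner_eq_zero_of_eigenvectors hy hz
  have hzy : ⟪z, y⟫_ℝ = 0 := by rw [real_inner_comm, hyz]
  refine and_congr ?_ ?_
  · rw [← sq_eq_sq₀ (norm_nonneg _) zero_le_one, norm_add_sq_real, hyz, mul_zero, add_zero, one_pow]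
  · rw [map_add, hy, hz]
    simp only [inner_add_left, inner_add_right, real_inner_smul_right, hyz, hzy,
      real_inner_self_eq_norm_sq]
    ring_nf

lemma ellipse_mem_quadricLink (h : IsCliffordOp D α) {a b w : Euc n} (ha : D a = α • a)
    (hb : D b = -α⁻¹ • b) (hab : a + b ∈ quadricLink D) (hw : D w = α • w) (haw : ⟪a, w⟫_ℝ = 0)
    (hnorm : ‖w‖ = ‖a‖) (t : ℝ) : Real.cos t • a + Real.sin t • w + b ∈ quadricLink D := by
  have heig : D (Real.cos t • a + Real.sin t • w) = α • (Real.cos t • a + Real.sin t • w) := by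
    rw [map_add, map_smul, map_smul, ha, hw]
    module
  have hlen : ‖Real.cos t • a + Real.sin t • w‖ ^ 2 = ‖a‖ ^ 2 := by
    rw [norm_add_sq_real, real_inner_smul_left, real_inner_smul_right, haw, norm_smul, norm_smul,
      mul_pow, mul_pow, hnorm, Real.norm_eq_abs, Real.norm_eq_abs, sq_abs, sq_abs]
    linear_combination ‖a‖ ^ 2 * Real.sin_sq_add_cos_sq t
  rwa [h.add_mem_quadricLink_iff heig hb, hlen, ← h.add_mem_quadricLink_iff ha hb]

lemma inner_fderiv_gradient_le_of_isMaxOn (h : IsCliffordOp D α) {f : Euc n → ℝ}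
    (hf : ContDiff ℝ 2 f) {p v : Euc n} (hp : p ∈ quadricLink D)
    (hmax : IsMaxOn f (quadricLink D) p) (hv : D v = α • v) (hpv : ⟪p, v⟫_ℝ = 0) :
    ⟪fderiv ℝ (gradient f) p v, v⟫_ℝ ≤
      ⟪gradient f p, eigenProj D α p⟫_ℝ / ‖eigenProj D α p‖ ^ 2 * ‖v‖ ^ 2 := by
  rcases eq_or_ne v 0 with rfl | hv₀
  · simp
  have hα := h.pos
  set a := eigenProj D α p with ha
  set b := eigenProj (-D) α⁻¹ p
  have hab : a + b = p := h.eigenProj_add_eigenProj_neg p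
  have hDb : D b = -α⁻¹ • b := by rw [neg_smul, ← h.neg.map_eigenProj p, _root_.neg_apply, neg_neg]
  have ha₀ : ‖a‖ ≠ 0 := fun h₀ => by
    have hsq := h.norm_sq_eigenProj hp
    rw [← ha, h₀, zero_pow two_ne_zero] at hsq
    exact absurd hsq (by positivity)
  have hv₀' : ‖v‖ ≠ 0 := norm_ne_zero_iff.mpr hv₀
  have hav : ⟪a, v⟫_ℝ = 0 := by rw [ha, h.inner_eigenProj, h.eigenProj_of_map_eq hv, hpv]
  set w := (‖a‖ / ‖v‖) • v with hw
  have hmem := h.ellipse_mem_quadricLink (h.map_eigenProj p) hDb (by rwa [hab]) (w := w)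
    (by rw [hw, map_smul, hv, smul_comm]) (by rw [hw, real_inner_smul_right, hav, mul_zero])
    (by rw [hw, norm_smul, norm_div, norm_norm, norm_norm, div_mul_cancel₀ _ hv₀'])
  have key := inner_fderiv_gradient_le_of_ellipse hf fun t => by
    rw [hab]
    exact hmax (hmem t)
  rw [hab, hw, map_smul, real_inner_smul_left, real_inner_smul_right] at key
  calc ⟪fderiv ℝ (gradient f) p v, v⟫_ℝ
      = ‖a‖ / ‖v‖ * (‖a‖ / ‖v‖ * ⟪fderiv ℝ (gradient f) p v, v⟫_ℝ) * (‖v‖ ^ 2 / ‖a‖ ^ 2) := by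
        field_simp
    _ ≤ ⟪gradient f p, a⟫_ℝ * (‖v‖ ^ 2 / ‖a‖ ^ 2) := by gcongr
    _ = ⟪gradient f p, a⟫_ℝ / ‖a‖ ^ 2 * ‖v‖ ^ 2 := by ring

lemma eigenProj_linkTangentProj_comm (h : IsCliffordOp D α) (x v : Euc n) :
    eigenProj D α (linkTangentProj D x v) = linkTangentProj D x (eigenProj D α v) := by
  rw [eigenProj_apply, eigenProj_apply, map_smul, map_add, map_smul, h.linkTangentProj_map]

lemma isSymmetricProjection_eigenProj_comp (h : IsCliffordOp D α) (hx : x ∈ quadricLink D) :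
    ((eigenProj D α).comp (linkTangentProj D x) : Euc n →ₗ[ℝ] Euc n).IsSymmetricProjection where
  isIdempotentElem := LinearMap.ext fun v => by
    change eigenProj D α (linkTangentProj D x (eigenProj D α (linkTangentProj D x v))) =
      eigenProj D α (linkTangentProj D x v)
    rw [← h.eigenProj_linkTangentProj_comm,
      h.linkTangentProj_idem (ne_zero_of_mem_quadricLink hx) hx.2,
      h.eigenProj_of_map_eq (h.map_eigenProj _)]
  isSymmetric v w := by
    change ⟪eigenProj D α (linkTangentProj D x v), w⟫_ℝ =
      ⟪v, eigenProj D α (linkTangentProj D x w)⟫_ℝ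
    rw [h.inner_eigenProj, h.eigenProj_linkTangentProj_comm]
    exact isSymmetric_linkTangentProj D x v _

lemma coordTrace_eigenProj_comp (h : IsCliffordOp D α) (hx : x ∈ quadricLink D) :
    coordTrace ((eigenProj D α).comp (linkTangentProj D x)) =
      ‖eigenProj D α x‖ ^ 2 * ((n : ℝ) - 2) := by
  have hx₀ := ne_zero_of_mem_quadricLink hx
  calc coordTrace ((eigenProj D α).comp (linkTangentProj D x))
      = coordTrace fun v => (α + α⁻¹)⁻¹ •
          (D (linkTangentProj D x v) + α⁻¹ • linkTangentProj D x v) := rfl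
    _ = ‖eigenProj D α x‖ ^ 2 * ((n : ℝ) - 2) := by
        rw [coordTrace_smul, coordTrace_add, coordTrace_smul,
          h.coordTrace_map_linkTangentProj hx₀ hx.2, h.coordTrace_linkTangentProj hx₀ hx.2,
          h.norm_sq_eigenProj hx]
        ring

lemma coordTrace_hessian_eigenProj_le (h : IsCliffordOp D α) {f : Euc n → ℝ}
    (hf : ContDiff ℝ 2 f) {p : Euc n} (hp : p ∈ quadricLink D)
    (hmax : IsMaxOn f (quadricLink D) p) :
    coordTrace (fun v => fderiv ℝ (gradient f) p (eigenProj D α (linkTangentProj D p v))) ≤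
      ((n : ℝ) - 2) * ⟪gradient f p, eigenProj D α p⟫_ℝ := by
  have hα := h.pos
  have hp₀ := ne_zero_of_mem_quadricLink hp
  refine (coordTrace_comp_le_of_isSymmetricProjection (h.isSymmetricProjection_eigenProj_comp hp)
    fun v hv => ?_).trans_eq
      (?_ : ⟪gradient f p, eigenProj D α p⟫_ℝ / ‖eigenProj D α p‖ ^ 2 * _ = _)
  · replace hv : eigenProj D α (linkTangentProj D p v) = v := hv
    refine h.inner_fderiv_gradient_le_of_isMaxOn hf hp hmax ?_ ?_
    · rw [← hv, h.map_eigenProj]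
    · rw [← hv, h.eigenProj_linkTangentProj_comm, inner_linkTangentProj hp₀ hp.2]
  · rw [h.coordTrace_eigenProj_comp hp, h.norm_sq_eigenProj hp]
    field_simp

lemma sphLaplacian_quadricLink (h : IsCliffordOp D α) {f : Euc n → ℝ} (hf : ContDiff ℝ 2 f)
    {p : Euc n} (hp : p ∈ quadricLink D) :
    sphLaplacian D f p = coordTrace (fun v => fderiv ℝ (gradient f) p (linkTangentProj D p v)) -
      ((n : ℝ) - 2) * ⟪p, gradient f p⟫_ℝ := by
  set Q := linkTangentProj D p
  set H := fderiv ℝ (gradient f) p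
  have hp₀ := ne_zero_of_mem_quadricLink hp
  have hH : HasFDerivAt (gradient f) H p := (differentiable_gradient hf p).hasFDerivAt
  have hderiv : fderiv ℝ (fun y => sphTanProj D y (gradient f y)) p = _ :=
    ((hH.sub (((hasFDerivAt_id p).inner ℝ hH).smul (hasFDerivAt_id p))).sub
      ((D.hasFDerivAt.inner ℝ hH).smul D.hasFDerivAt)).fderiv
  have hQQ (v : Euc n) : Q (Q v) = Q v := h.linkTangentProj_idem hp₀ hp.2 v
  have hQp : Q p = 0 := by
    rw [linkTangentProj_apply, h.symm, hp.2, real_inner_self_eq_norm_sq, hp.1]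
    simp
  have hQD (v : Euc n) : Q (D v) = D (Q v) := h.linkTangentProj_map p v
  have hshape (v : Euc n) :
      sphTanProj D p (fderiv ℝ (fun y => sphTanProj D y (gradient f y)) p (sphTanProj D p v)) =
        Q (H (Q v)) - ⟪p, gradient f p⟫_ℝ • Q v - ⟪D p, gradient f p⟫_ℝ • D (Q v) := by
    rw [hderiv, sphTanProj_eq_linkTangentProj D hp.1]
    simp [Q, hQp, hQD, hQQ]
  have hcycle : coordTrace (fun v => Q (H (Q v))) = coordTrace (fun v => H (Q v)) := by
    simpa [hQQ] using coordTrace_comp_comm Q (H.comp Q)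
  rw [sphLaplacian, funext hshape, coordTrace_sub, coordTrace_sub, coordTrace_smul,
    coordTrace_smul, h.coordTrace_map_linkTangentProj hp₀ hp.2,
    h.coordTrace_linkTangentProj hp₀ hp.2, hcycle]
  ring

lemma sphLaplacian_nonpos_of_isMaxOn (h : IsCliffordOp D α) {f : Euc n → ℝ}
    (hf : ContDiff ℝ 2 f) {p : Euc n} (hp : p ∈ quadricLink D)
    (hmax : IsMaxOn f (quadricLink D) p) : sphLaplacian D f p ≤ 0 := by
  have hpos := h.coordTrace_hessian_eigenProj_le hf hp hmax
  have hneg := h.neg.coordTrace_hessian_eigenProj_le hf (p := p) (by rwa [quadricLink_neg])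
    (by rwa [quadricLink_neg])
  rw [linkTangentProj_neg] at hneg
  have hgrad : ⟪p, gradient f p⟫_ℝ =
      ⟪gradient f p, eigenProj D α p⟫_ℝ + ⟪gradient f p, eigenProj (-D) α⁻¹ p⟫_ℝ := by
    rw [← inner_add_right, h.eigenProj_add_eigenProj_neg, real_inner_comm]
  have hsplit := coordTrace_add
    (fun v => fderiv ℝ (gradient f) p (eigenProj D α (linkTangentProj D p v)))
    (fun v => fderiv ℝ (gradient f) p (eigenProj (-D) α⁻¹ (linkTangentProj D p v)))
  simp only [← map_add, h.eigenProj_add_eigenProj_neg] at hsplit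
  rw [h.sphLaplacian_quadricLink hf hp, hgrad]
  linarith

lemma sphLaplacian_quadricLink_neg (h : IsCliffordOp D α) {f : Euc n → ℝ} (hf : ContDiff ℝ 2 f)
    {p : Euc n} (hp : p ∈ quadricLink D) :
    sphLaplacian D (fun x => -f x) p = -sphLaplacian D f p := by
  have hgrad : gradient (fun x => -f x) = fun x => (-1 : ℝ) • gradient f x := by
    ext1 x
    simp [gradient, fderiv_fun_neg]
  rw [h.sphLaplacian_quadricLink hf hp, h.sphLaplacian_quadricLink hf.neg hp, hgrad,
    fderiv_fun_const_smul (differentiable_gradient hf p)]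
  simp only [_root_.smul_apply]
  rw [coordTrace_smul, real_inner_smul_right]
  ring

lemma neg_le_of_isJacobiEigenvalue (h : IsCliffordOp D α) {μ : ℝ}
    (hμ : IsJacobiEigenvalue (quadricLink D) D μ) : -((n : ℝ) - 2) ≤ μ := by
  obtain ⟨f, hf, ⟨q, hq, hfq⟩, heq⟩ := hμ
  have bound (g : Euc n → ℝ) (hg : ContDiff ℝ 2 g) (hgq : 0 < g q) (hgeq : ∀ p ∈ quadricLink D,
      -sphLaplacian D g p - sphNormSqA D p * g p = μ * g p) : -((n : ℝ) - 2) ≤ μ := by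
    obtain ⟨p, hp, hmax⟩ :=
      (isCompact_quadricLink D).exists_isMaxOn ⟨q, hq⟩ hg.continuous.continuousOn
    have hgp : 0 < g p := hgq.trans_le (hmax hq)
    have hlap := h.sphLaplacian_nonpos_of_isMaxOn hg hp hmax
    have heq := hgeq p hp
    rw [h.sphNormSqA_quadricLink hp] at heq
    refine le_of_mul_le_mul_right ?_ hgp
    linarith
  have hf₂ : ContDiff ℝ 2 f := hf.of_le (by norm_cast)
  rcases hfq.lt_or_gt with hneg | hpos
  · refine bound (fun x => -f x) hf₂.neg (neg_pos.mpr hneg) fun p hp => ?_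
    rw [h.sphLaplacian_quadricLink_neg hf₂ hp]
    linarith [heq p hp]
  · exact bound f hf₂ hpos heq

lemma isJacobiEigenvalue_quadricLink (h : IsCliffordOp D α) (hne : (quadricLink D).Nonempty) :
    IsJacobiEigenvalue (quadricLink D) D (-((n : ℝ) - 2)) := by
  obtain ⟨q, hq⟩ := hne
  refine ⟨fun _ => 1, contDiff_const, ⟨q, hq, one_ne_zero⟩, fun p hp => ?_⟩
  have hgrad : gradient (fun _ : Euc n => (1 : ℝ)) = fun _ => 0 := by
    ext1 x
    simp [gradient]
  rw [h.sphLaplacian_quadricLink contDiff_const hp, h.sphNormSqA_quadricLink hp, hgrad]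
  simp [coordTrace]

lemma isLeast_isJacobiEigenvalue_quadricLink (h : IsCliffordOp D α)
    (hne : (quadricLink D).Nonempty) :
    IsLeast {μ | IsJacobiEigenvalue (quadricLink D) D μ} (-((n : ℝ) - 2)) :=
  ⟨h.isJacobiEigenvalue_quadricLink hne, fun _ => h.neg_le_of_isJacobiEigenvalue⟩

end IsCliffordOp

end JacobiSpectrum

section Cone

variable {n : ℕ} {D : Euc n →L[ℝ] Euc n} {α m R₀ : ℝ} {x : Euc n}

/-- The part of the cone `⟪x, D x⟫ = 0` outside the ball of radius `R₀`. -/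
def quadricCone (R₀ : ℝ) (D : Euc n →L[ℝ] Euc n) : Set (Euc n) :=
  {x | R₀ ≤ ‖x‖ ∧ ⟪x, D x⟫_ℝ = 0}

/-- The unit normal of the cone `⟪x, D x⟫ = 0` for the Schwarzschild metric, written as `f⁻¹` times
the Euclidean unit normal. -/
noncomputable def coneNormal (n : ℕ) (m : ℝ) (D : Euc n →L[ℝ] Euc n) (x : Euc n) : Euc n :=
  (schwFactor n m x)⁻¹ • ‖x‖⁻¹ • D x

lemma inner_self_map_smul (D : Euc n →L[ℝ] Euc n) (t : ℝ) (x : Euc n) :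
    ⟪t • x, D (t • x)⟫_ℝ = t ^ 2 * ⟪x, D x⟫_ℝ := by
  rw [map_smul, real_inner_smul_left, real_inner_smul_right]
  ring

lemma inner_coneNormal (hx : ⟪x, D x⟫_ℝ = 0) : ⟪x, coneNormal n m D x⟫_ℝ = 0 := by
  rw [coneNormal, real_inner_smul_right, real_inner_smul_right, hx, mul_zero, mul_zero]

lemma truncatedCone_quadricLink (hR : 0 < R₀) (D : Euc n →L[ℝ] Euc n) :
    truncatedCone R₀ (quadricLink D) = quadricCone R₀ D := by
  ext x
  refine and_congr_right fun hx => ⟨?_, fun hq => ?_⟩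
  · rintro ⟨t, -, y, hy, rfl⟩
    rw [inner_self_map_smul, hy.2, mul_zero]
  · have hr : 0 < ‖x‖ := hR.trans_le hx
    refine ⟨‖x‖, hr, ‖x‖⁻¹ • x, ⟨norm_smul_inv_norm (norm_pos_iff.mp hr), ?_⟩, ?_⟩
    · rw [inner_self_map_smul, hq, mul_zero]
    · rw [smul_inv_smul₀ hr.ne']

lemma ne_zero_of_mem_quadricCone (hR : 0 < R₀) (hx : x ∈ quadricCone R₀ D) : x ≠ 0 :=
  norm_pos_iff.mp (hR.trans_le hx.1)

lemma isClosed_quadricCone (R₀ : ℝ) (D : Euc n →L[ℝ] Euc n) : IsClosed (quadricCone R₀ D) :=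
  (isClosed_le continuous_const continuous_norm).inter
    (isClosed_eq (contDiff_inner_self_map D).continuous continuous_const)

lemma smul_mem_quadricCone {q : Euc n} (hR : 0 ≤ R₀) (hq : q ∈ quadricLink D) :
    R₀ • q ∈ quadricCone R₀ D ∧ ‖R₀ • q‖ = R₀ := by
  have hnorm : ‖R₀ • q‖ = R₀ := by rw [norm_smul_of_nonneg hR, hq.1, mul_one]
  exact ⟨⟨hnorm.ge, by rw [inner_self_map_smul, hq.2, mul_zero]⟩, hnorm⟩

lemma contDiffAt_schwFactor (hm : 0 < m) (hx : x ≠ 0) : ContDiffAt ℝ ∞ (schwFactor n m) x := by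
  have : 0 < ‖x‖ := norm_pos_iff.mpr hx
  refine ContDiffAt.rpow_const_of_ne ?_ (by positivity)
  exact contDiffAt_const.add (contDiffAt_const.div
    (contDiffAt_const.mul ((contDiffAt_norm ℝ hx).pow _)) (by positivity))

namespace IsCliffordOp

/-- The factor `f` is radial and the normal is tangent to the spheres about the origin, so the
shape operator is `f⁻¹` times the Euclidean one. -/
lemma shapeOp_coneNormal (h : IsCliffordOp D α) (hn : 2 < n) (hm : 0 < m) (hx₀ : x ≠ 0)
    (hx : ⟪x, D x⟫_ℝ = 0) (v : Euc n) :
    shapeOp (schwMetric n m) (coneNormal n m D) x v =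
      -(schwFactor n m x * ‖x‖)⁻¹ • D (linkTangentProj D x v) := by
  have hr := norm_pos_iff.mpr hx₀
  have hf' := hasFDerivAt_schwFactor hn hm hx₀
  have hν := hasFDerivAt_inv_norm_smul D hx₀
  set w := v - ⟪‖x‖⁻¹ • D x, v⟫_ℝ • ‖x‖⁻¹ • D x with hw
  have hproj : w - (‖x‖ ^ 2)⁻¹ • ⟪x, w⟫_ℝ • x = linkTangentProj D x v := by
    simp only [hw, linkTangentProj_apply, inner_sub_right, real_inner_smul_left,
      real_inner_smul_right, hx]
    module
  have hdν : fderiv ℝ (fun y => ‖y‖⁻¹ • D y) x w = ‖x‖⁻¹ • D (linkTangentProj D x v) := by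
    rw [hν.fderiv, ← hproj, map_sub D, map_smul D, map_smul D]
    rfl
  have horth : ⟪‖x‖⁻¹ • D x, ‖x‖⁻¹ • D (linkTangentProj D x v)⟫_ℝ = 0 := by
    rw [real_inner_smul_left, real_inner_smul_right, h.inner_map_map,
      h.inner_map_linkTangentProj hx₀ hx, inner_linkTangentProj hx₀ hx]
    ring
  refine (shapeOp_conformalMetric_inv_smul (schwFactor_pos hm hx₀).ne' hf'.differentiableAt
    hν.differentiableAt ?_ ?_ v).trans ?_
  · rw [norm_smul_of_nonneg (inv_nonneg.mpr hr.le), h.norm_map hx, inv_mul_cancel₀ hr.ne']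
  · simp [hf'.fderiv, hx]
  · rw [← hw, hdν, horth, zero_smul, sub_zero, smul_smul, mul_inv, neg_mul]

lemma meanCurvature_coneNormal (h : IsCliffordOp D α) (hn : 2 < n) (hm : 0 < m) (hx₀ : x ≠ 0)
    (hx : ⟪x, D x⟫_ℝ = 0) : meanCurvature (schwMetric n m) (coneNormal n m D) x = 0 := by
  rw [meanCurvature, funext (h.shapeOp_coneNormal hn hm hx₀ hx), coordTrace_smul,
    h.coordTrace_map_linkTangentProj hx₀ hx, mul_zero]

lemma normSqA_coneNormal (h : IsCliffordOp D α) (hn : 2 < n) (hm : 0 < m) (hx₀ : x ≠ 0)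
    (hx : ⟪x, D x⟫_ℝ = 0) :
    normSqA (schwMetric n m) (coneNormal n m D) x =
      ((n : ℝ) - 2) / (schwFactor n m x * ‖x‖) ^ 2 := by
  simp_rw [normSqA, h.shapeOp_coneNormal hn hm hx₀ hx, map_smul, smul_smul]
  rw [coordTrace_smul, h.coordTrace_sq_map_linkTangentProj hx₀ hx, neg_mul_neg, ← mul_inv,
    ← pow_two, div_eq_inv_mul]

lemma isInteriorPoint_quadricCone (h : IsCliffordOp D α) (hR : 0 ≤ R₀)
    (hx : x ∈ quadricCone R₀ D) (hxR : R₀ < ‖x‖) :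
    IsInteriorPoint (quadricCone R₀ D) x {v | ⟪D x, v⟫_ℝ = 0} := by
  refine ⟨{y | R₀ < ‖y‖}, fun y => ⟪y, D y⟫_ℝ, isOpen_lt continuous_const continuous_norm, hxR,
    (contDiff_inner_self_map D).contDiffOn, hx.2, fun hzero => ?_, ?_, ?_⟩
  · have hDx := h.fderiv_inner_self_map x (D x)
    rw [hzero, real_inner_self_eq_norm_sq, h.norm_map hx.2] at hDx
    exact (mul_pos two_pos (pow_pos (hR.trans_lt hxR) 2)).ne hDx
  · ext y
    exact ⟨fun hy => ⟨hy.2, hy.1.2⟩, fun hy => ⟨⟨le_of_lt hy.1, hy.2⟩, hy.1⟩⟩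
  · ext v; simp [h.fderiv_inner_self_map]

lemma isBoundaryPoint_quadricCone (h : IsCliffordOp D α) (hR : 0 < R₀)
    (hx : x ∈ quadricCone R₀ D) (hxR : ‖x‖ = R₀) :
    IsBoundaryPoint (quadricCone R₀ D) x {v | ⟪D x, v⟫_ℝ = 0} := by
  have hψ (v : Euc n) : fderiv ℝ (fun y : Euc n => ‖y‖ ^ 2 - R₀ ^ 2) x v = 2 * ⟪x, v⟫_ℝ := by
    rw [fderiv_sub_const, (hasStrictFDerivAt_norm_sq x).hasFDerivAt.fderiv]
    simp
  refine ⟨Set.univ, fun y => ⟪y, D y⟫_ℝ, fun y => ‖y‖ ^ 2 - R₀ ^ 2, isOpen_univ, trivial,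
    (contDiff_inner_self_map D).contDiffOn, ((contDiff_norm_sq ℝ).sub contDiff_const).contDiffOn,
    hx.2, by simp [hxR], ?_, ?_, ?_⟩
  · refine LinearIndependent.pair_iff.mpr fun s t hst => ?_
    have hDx := DFunLike.congr_fun hst (D x)
    have hx' := DFunLike.congr_fun hst x
    simp only [add_apply, smul_apply, h.fderiv_inner_self_map, hψ, zero_apply, hx.2,
      real_inner_comm x (D x), real_inner_self_eq_norm_sq, h.norm_map hx.2, hxR, smul_eq_mul]
      at hDx hx'
    exact ⟨by simpa [hR.ne'] using hDx, by simpa [hR.ne'] using hx'⟩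
  · ext y
    simp only [quadricCone, Set.mem_inter_iff, Set.mem_ofPred_eq, Set.mem_univ, and_true, true_and,
      sub_nonneg]
    rw [sq_le_sq₀ hR.le (norm_nonneg y), and_comm]
  · ext v; simp [h.fderiv_inner_self_map]

lemma schwMetric_coneNormal_self (h : IsCliffordOp D α) (hm : 0 < m) (hx₀ : x ≠ 0)
    (hx : ⟪x, D x⟫_ℝ = 0) :
    schwMetric n m x (coneNormal n m D x) (coneNormal n m D x) = 1 := by
  have hr := norm_pos_iff.mpr hx₀
  have hf := schwFactor_pos hm hx₀
  refine (conformalMetric_self _).trans ?_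
  rw [coneNormal, norm_smul_of_nonneg (inv_nonneg.mpr hf.le),
    norm_smul_of_nonneg (inv_nonneg.mpr hr.le), h.norm_map hx, inv_mul_cancel₀ hr.ne', mul_one,
    mul_inv_cancel₀ hf.ne', one_pow]

lemma isUnitNormal_coneNormal (h : IsCliffordOp D α) (hm : 0 < m) (hR : 0 < R₀) :
    IsUnitNormal (schwMetric n m) (quadricCone R₀ D) (coneNormal n m D) where
  smooth := by
    refine ⟨{x | x ≠ 0}, isOpen_ne, fun x => ne_zero_of_mem_quadricCone hR,
      fun x hx => ContDiffAt.contDiffWithinAt ?_⟩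
    exact ((contDiffAt_schwFactor hm hx).inv (schwFactor_pos hm hx).ne').smul
      (((contDiffAt_norm ℝ hx).inv (norm_ne_zero_iff.mpr hx)).smul D.contDiff.contDiffAt)
  unit p hp := h.schwMetric_coneNormal_self hm (ne_zero_of_mem_quadricCone hR hp) hp.2
  normal p hp := by
    refine ⟨{v | ⟪D p, v⟫_ℝ = 0}, ?_, fun v hv => ?_⟩
    · exact hp.1.lt_or_eq.imp (h.isInteriorPoint_quadricCone hR.le hp)
        fun hpR => h.isBoundaryPoint_quadricCone hR hp hpR.symm
    · rw [schwMetric, coneNormal, real_inner_smul_left, real_inner_smul_left, hv.out]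
      ring

lemma isFreeBoundaryMinimal_quadricCone (h : IsCliffordOp D α) (hn : 2 < n) (hm : 0 < m)
    (hne : (quadricLink D).Nonempty) :
    IsFreeBoundaryMinimal n m (quadricCone (horizonRadius n m) D) (coneNormal n m D) := by
  have hR := horizonRadius_pos n hm
  have ⟨q, hq⟩ := hne
  have hmem := smul_mem_quadricCone hR.le hq
  exact
    { properly_embedded :=
        { nonempty := ⟨_, hmem.1⟩
          isClosed := isClosed_quadricCone _ D
          subset := fun p hp => hp.1
          interior_point := fun p hp hpR => ⟨_, h.isInteriorPoint_quadricCone hR.le hp hpR⟩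
          boundary_point := fun p hp hpR => ⟨_, h.isBoundaryPoint_quadricCone hR hp hpR⟩ }
      unit_normal := h.isUnitNormal_coneNormal hm hR
      minimal := fun p hp =>
        h.meanCurvature_coneNormal hn hm (ne_zero_of_mem_quadricCone hR hp) hp.2
      boundary_nonempty := ⟨_, hmem⟩
      orthogonal := fun p hp _ => by
        rw [schwMetric, radialNormal, real_inner_smul_right, real_inner_comm, inner_coneNormal hp.2,
          mul_zero, mul_zero] }

lemma not_isTotallyGeodesic_quadricCone (h : IsCliffordOp D α) (hn : 2 < n) (hm : 0 < m)
    (hR : 0 < R₀) (hne : (quadricCone R₀ D).Nonempty) :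
    ¬ IsTotallyGeodesic (schwMetric n m) (quadricCone R₀ D) (coneNormal n m D) := by
  intro hgeod
  obtain ⟨p, hp⟩ := hne
  have hp₀ := ne_zero_of_mem_quadricCone hR hp
  have hf := schwFactor_pos hm hp₀
  have : 0 < ‖p‖ := norm_pos_iff.mpr hp₀
  have hshape := hgeod.shapeOp_eq_zero hf.ne' hp (h.schwMetric_coneNormal_self hm hp₀ hp.2)
  have hA : normSqA (schwMetric n m) (coneNormal n m D) p = 0 := by
    rw [normSqA, coordTrace]
    exact Finset.sum_eq_zero fun i _ => congrArg (fun v : Euc n => v i) (hshape _)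
  have hn' : (0 : ℝ) < n - 2 := sub_pos.mpr (by exact_mod_cast hn)
  rw [h.normSqA_coneNormal hn hm hp₀ hp.2] at hA
  exact (by positivity : (n - 2 : ℝ) / (schwFactor n m p * ‖p‖) ^ 2 ≠ 0) hA

end IsCliffordOp

end Cone

section HomogeneousMeasure

open scoped Pointwise

lemma integral_nonneg_iff_lintegral_neg_le {X : Type*} [MeasurableSpace X] {μ : Measure X}
    {f : X → ℝ} (hf : Integrable f μ) :
    0 ≤ ∫ x, f x ∂μ ↔
      ∫⁻ x, ENNReal.ofReal (-f x) ∂μ ≤ ∫⁻ x, ENNReal.ofReal (f x) ∂μ := by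
  rw [integral_eq_lintegral_pos_part_sub_lintegral_neg_part hf, sub_nonneg]
  exact ENNReal.toReal_le_toReal hf.neg.lintegral_lt_top.ne hf.lintegral_lt_top.ne

variable {E : Type*} [NormedAddCommGroup E]

/-- The annulus `1 ≤ ‖x‖ ≤ 2`. -/
def unitShell (E : Type*) [Norm E] : Set E := {x | 1 ≤ ‖x‖ ∧ ‖x‖ ≤ 2}

lemma measurableSet_unitShell [MeasurableSpace E] [OpensMeasurableSpace E] :
    MeasurableSet (unitShell E) :=
  (measurableSet_le measurable_const measurable_norm).inter
    (measurableSet_le measurable_norm measurable_const)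

variable [NormedSpace ℝ E]

lemma inv_smul_mem_unitShell {t : ℝ} (ht : 0 < t) {x : E} :
    t⁻¹ • x ∈ unitShell E ↔ t ∈ Set.Icc (‖x‖ / 2) ‖x‖ := by
  rw [unitShell, Set.mem_ofPred_eq, norm_smul, norm_inv, Real.norm_of_nonneg ht.le,
    inv_mul_eq_div, one_le_div ht, div_le_iff₀ ht, Set.mem_Icc, div_le_iff₀ two_pos, and_comm,
    mul_comm t]

lemma lintegral_inv_indicator_unitShell {x : E} (hx : x ≠ 0) :
    ∫⁻ t in Set.Ioi (0 : ℝ), ENNReal.ofReal t⁻¹ * (unitShell E).indicator 1 (t⁻¹ • x) =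
      ENNReal.ofReal (Real.log 2) := by
  have hr : 0 < ‖x‖ := norm_pos_iff.mpr hx
  have hsub : Set.Icc (‖x‖ / 2) ‖x‖ ⊆ Set.Ioi (0 : ℝ) := fun t ht => (half_pos hr).trans_le ht.1
  have hle : ‖x‖ / 2 ≤ ‖x‖ := half_le_self hr.le
  calc ∫⁻ t in Set.Ioi (0 : ℝ), ENNReal.ofReal t⁻¹ * (unitShell E).indicator 1 (t⁻¹ • x)
    _ = ∫⁻ t in Set.Ioi (0 : ℝ),
          (Set.Icc (‖x‖ / 2) ‖x‖).indicator (fun t => ENNReal.ofReal t⁻¹) t := by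
      refine setLIntegral_congr_fun measurableSet_Ioi fun t ht => ?_
      by_cases hmem : t ∈ Set.Icc (‖x‖ / 2) ‖x‖ <;>
        simp [Set.indicator, inv_smul_mem_unitShell ht, hmem]
    _ = ∫⁻ t in Set.Icc (‖x‖ / 2) ‖x‖, ENNReal.ofReal t⁻¹ := by
      rw [setLIntegral_indicator measurableSet_Icc, Set.inter_eq_self_of_subset_left hsub]
    _ = ENNReal.ofReal (∫ t in (‖x‖ / 2)..‖x‖, t⁻¹) := by
      rw [intervalIntegral.integral_of_le hle, ← integral_Icc_eq_integral_Ioc,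
        ofReal_integral_eq_lintegral_ofReal]
      · exact (continuousOn_inv₀.mono fun t ht => (hsub ht).ne').integrableOn_compact isCompact_Icc
      · filter_upwards [ae_restrict_mem measurableSet_Icc] with t ht
        exact inv_nonneg.mpr (hsub ht).le
    _ = ENNReal.ofReal (Real.log 2) := by
      rw [integral_inv_of_pos (half_pos hr) hr, div_div_cancel₀ hr.ne']

lemma integral_ray_nonneg_of_normalized {d : ℕ} {F : E → ℝ} {x : E} (hx : x ≠ 0)
    (h : 0 ≤ ∫ t in Set.Ioi (0 : ℝ), t ^ d * F (t • ‖x‖⁻¹ • x)) :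
    0 ≤ ∫ t in Set.Ioi (0 : ℝ), t ^ d * F (t • x) := by
  have hr : 0 < ‖x‖ := norm_pos_iff.mpr hx
  have hscale := integral_comp_mul_right_Ioi (fun t => t ^ d * F (t • ‖x‖⁻¹ • x)) 0 hr
  simp only [mul_pow, mul_smul, smul_inv_smul₀ hr.ne', zero_mul, mul_right_comm _ (‖x‖ ^ d),
    integral_mul_const] at hscale
  exact nonneg_of_mul_nonneg_left
    (hscale.symm ▸ smul_nonneg (inv_nonneg.mpr hr.le) h) (pow_pos hr d)

variable [MeasurableSpace E] {ν : Measure E} {p d : ℕ}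

/-- The measure `ν` is homogeneous of degree `p`, that is `ν (t • s) = t ^ p * ν s` for `t > 0`.
The condition is stated in the form in which it gives the change of variables in integrals. -/
def IsHomogeneousMeasure (p : ℕ) (ν : Measure E) : Prop :=
  ∀ t : ℝ, 0 < t → ENNReal.ofReal (t ^ p) • ν.map (t • ·) = ν

variable [BorelSpace E]

lemma IsHomogeneousMeasure.lintegral_comp_smul (hν : IsHomogeneousMeasure p ν) {t : ℝ}
    (ht : 0 < t) {F : E → ℝ≥0∞} (hF : Measurable F) :
    ENNReal.ofReal (t ^ p) * ∫⁻ x, F (t • x) ∂ν = ∫⁻ x, F x ∂ν := by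
  conv_rhs => rw [← hν t ht]
  rw [lintegral_smul_measure, lintegral_map hF (measurable_const_smul t), smul_eq_mul]

/-- Polar coordinates, averaged over the radius of the reference sphere. This avoids the
disintegration of `ν` along spheres. -/
lemma IsHomogeneousMeasure.log_two_mul_lintegral [SFinite ν]
    (hν : IsHomogeneousMeasure (d + 1) ν) {F : E → ℝ≥0∞} (hF : Measurable F) (hF₀ : F 0 = 0) :
    ENNReal.ofReal (Real.log 2) * ∫⁻ x, F x ∂ν =
      ∫⁻ x in unitShell E, (∫⁻ t in Set.Ioi (0 : ℝ), ENNReal.ofReal (t ^ d) * F (t • x)) ∂ν := by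
  have hind : Measurable ((unitShell E).indicator (1 : E → ℝ≥0∞)) :=
    measurable_one.indicator measurableSet_unitShell
  have hdil : ∀ t ∈ Set.Ioi (0 : ℝ),
      ∫⁻ x, ENNReal.ofReal t⁻¹ * (unitShell E).indicator 1 (t⁻¹ • x) * F x ∂ν =
        ∫⁻ x in unitShell E, ENNReal.ofReal (t ^ d) * F (t • x) ∂ν := by
    intro t (ht : 0 < t)
    rw [← hν.lintegral_comp_smul ht (by fun_prop), ← lintegral_const_mul _ (by fun_prop),
      ← lintegral_indicator measurableSet_unitShell]
    refine lintegral_congr fun x => ?_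
    have hpow : ENNReal.ofReal (t ^ (d + 1)) * ENNReal.ofReal t⁻¹ = ENNReal.ofReal (t ^ d) := by
      rw [← ENNReal.ofReal_mul (by positivity), pow_succ, mul_inv_cancel_right₀ ht.ne']
    rw [inv_smul_smul₀ ht.ne', ← mul_assoc, ← mul_assoc, hpow]
    by_cases hx : x ∈ unitShell E <;> simp [hx]
  calc ENNReal.ofReal (Real.log 2) * ∫⁻ x, F x ∂ν
    _ = ∫⁻ x, (∫⁻ t in Set.Ioi (0 : ℝ),
          ENNReal.ofReal t⁻¹ * (unitShell E).indicator 1 (t⁻¹ • x) * F x) ∂ν := by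
      rw [← lintegral_const_mul _ hF]
      refine lintegral_congr fun x => ?_
      rcases eq_or_ne x 0 with rfl | hx
      · simp [hF₀]
      · rw [lintegral_mul_const _ (by fun_prop), lintegral_inv_indicator_unitShell hx]
    _ = ∫⁻ t in Set.Ioi (0 : ℝ),
          ∫⁻ x, ENNReal.ofReal t⁻¹ * (unitShell E).indicator 1 (t⁻¹ • x) * F x ∂ν :=
      lintegral_lintegral_swap (by fun_prop)
    _ = ∫⁻ t in Set.Ioi (0 : ℝ), ∫⁻ x in unitShell E, ENNReal.ofReal (t ^ d) * F (t • x) ∂ν :=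
      setLIntegral_congr_fun measurableSet_Ioi hdil
    _ = ∫⁻ x in unitShell E, (∫⁻ t in Set.Ioi (0 : ℝ), ENNReal.ofReal (t ^ d) * F (t • x)) ∂ν :=
      lintegral_lintegral_swap (by fun_prop)

lemma IsHomogeneousMeasure.ae_integrableOn_ray [SFinite ν] (hν : IsHomogeneousMeasure (d + 1) ν)
    {F : E → ℝ} (hFm : Measurable F) (hF : Integrable F ν) (hF₀ : F 0 = 0) :
    ∀ᵐ x ∂ν.restrict (unitShell E),
      IntegrableOn (fun t => t ^ d * F (t • x)) (Set.Ioi (0 : ℝ)) := by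
  have hfin : ∫⁻ x in unitShell E, (∫⁻ t in Set.Ioi (0 : ℝ),
      ENNReal.ofReal (t ^ d) * ‖F (t • x)‖ₑ) ∂ν ≠ ⊤ := by
    rw [← hν.log_two_mul_lintegral hFm.enorm (by simp [hF₀])]
    exact ENNReal.mul_ne_top ENNReal.ofReal_ne_top hF.2.ne
  have hmeas : Measurable fun x : E =>
      ∫⁻ t in Set.Ioi (0 : ℝ), ENNReal.ofReal (t ^ d) * ‖F (t • x)‖ₑ :=
    Measurable.lintegral_prod_right (by fun_prop)
  filter_upwards [ae_lt_top hmeas hfin] with x hx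
  refine ⟨Measurable.aestronglyMeasurable (by fun_prop), ?_⟩
  refine (setLIntegral_congr_fun measurableSet_Ioi fun t (ht : 0 < t) => ?_).trans_lt hx
  rw [enorm_mul, Real.enorm_of_nonneg (by positivity)]

lemma IsHomogeneousMeasure.integral_nonneg_of_ae_ray [SFinite ν]
    (hν : IsHomogeneousMeasure (d + 1) ν) {F : E → ℝ} (hFm : Measurable F) (hF₀ : F 0 = 0)
    (hray : ∀ᵐ x ∂ν.restrict (unitShell E), 0 ≤ ∫ t in Set.Ioi (0 : ℝ), t ^ d * F (t • x)) :
    0 ≤ ∫ x, F x ∂ν := by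
  by_cases hF : Integrable F ν
  swap
  · rw [integral_undef hF]
  have hlog : ENNReal.ofReal (Real.log 2) ≠ 0 :=
    (ENNReal.ofReal_pos.mpr (Real.log_pos one_lt_two)).ne'
  rw [integral_nonneg_iff_lintegral_neg_le hF,
    ← ENNReal.mul_le_mul_iff_right hlog ENNReal.ofReal_ne_top,
    hν.log_two_mul_lintegral (by fun_prop) (by simp [hF₀]),
    hν.log_two_mul_lintegral (by fun_prop) (by simp [hF₀])]
  refine lintegral_mono_ae ?_
  filter_upwards [hray, hν.ae_integrableOn_ray hFm hF hF₀] with x hx hint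
  have hmul : ∀ t ∈ Set.Ioi (0 : ℝ), ∀ y : ℝ,
      ENNReal.ofReal (t ^ d) * ENNReal.ofReal y = ENNReal.ofReal (t ^ d * y) := fun t ht y =>
    (ENNReal.ofReal_mul (pow_nonneg (le_of_lt ht) d)).symm
  rw [setLIntegral_congr_fun measurableSet_Ioi fun t ht => hmul t ht _,
    setLIntegral_congr_fun measurableSet_Ioi fun t ht => hmul t ht _]
  simpa only [mul_neg] using (integral_nonneg_iff_lintegral_neg_le hint).mp hx

lemma isHomogeneousMeasure_euclideanHausdorffMeasure_restrict (p : ℕ) {C : Set E}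
    (hsmul : ∀ t : ℝ, 0 < t → ∀ x, t • x ∈ C ↔ x ∈ C) :
    IsHomogeneousMeasure p ((Measure.euclideanHausdorffMeasure p).restrict C) := by
  intro t ht
  ext s hs
  have hpre : (fun x : E => t • x) ⁻¹' s ∩ C = t⁻¹ • (s ∩ C) := by
    rw [← Set.preimage_smul₀ ht.ne', Set.preimage_inter]
    congr 1
    ext x
    exact (hsmul t ht x).symm
  have hfac : ENNReal.ofReal (t ^ p) * (‖t⁻¹‖₊ ^ p : NNReal) = 1 := by
    rw [← ENNReal.ofReal_coe_nnreal, ← ENNReal.ofReal_mul (by positivity), NNReal.coe_pow,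
      coe_nnnorm, norm_inv, Real.norm_of_nonneg ht.le, ← mul_pow, mul_inv_cancel₀ ht.ne', one_pow,
      ENNReal.ofReal_one]
  rw [Measure.smul_apply, Measure.map_apply (measurable_const_smul t) hs,
    Measure.restrict_apply (measurable_const_smul t hs), Measure.restrict_apply hs, hpre,
    Measure.euclideanHausdorffMeasure_smul₀ p (inv_ne_zero ht.ne'), ENNReal.smul_def, smul_eq_mul,
    smul_eq_mul, ← mul_assoc, hfac, one_mul]

end HomogeneousMeasure

section LevelSet

lemma sigmaFinite_restrict_of_finiteAtFilter {X : Type*} [TopologicalSpace X]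
    [SecondCountableTopology X] [MeasurableSpace X] {μ : Measure X} {s : Set X}
    (hs : MeasurableSet s) (hμ : ∀ x ∈ s, μ.FiniteAtFilter (𝓝[s] x)) :
    SigmaFinite (μ.restrict s) := by
  choose! U hU hfin using hμ
  obtain ⟨t, hts, htc, hcov⟩ := TopologicalSpace.countable_cover_nhdsWithin hU
  refine Measure.sigmaFinite_of_countable (htc.image U |>.insert sᶜ) ?_ ?_
  · rintro _ (rfl | ⟨x, hx, rfl⟩)
    · simp [Measure.restrict_apply hs.compl]
    · exact (Measure.restrict_apply_le s (U x)).trans_lt (hfin x (hts hx))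
  · rw [Set.sUnion_insert, Set.sUnion_image, Set.eq_univ_iff_forall]
    exact fun x => (em (x ∈ s)).symm.imp id fun hx => hcov hx

lemma finiteAtFilter_levelSet_of_hasStrictFDerivAt {E F : Type*} [NormedAddCommGroup E]
    [NormedSpace ℝ E] [FiniteDimensional ℝ E] [MeasurableSpace E] [BorelSpace E]
    [NormedAddCommGroup F] [NormedSpace ℝ F] [FiniteDimensional ℝ F] {φ : E → F} {φ' : E →L[ℝ] F}
    {x : E} (hφ : HasStrictFDerivAt φ φ' x) (hφ' : φ'.range = ⊤) :
    (Measure.euclideanHausdorffMeasure (Module.finrank ℝ φ'.ker) : Measure E).FiniteAtFilter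
      (𝓝[{y | φ y = φ x}] x) := by
  have := FiniteDimensional.complete ℝ E
  set Ψ := hφ.implicitFunction φ φ' hφ' (φ x)
  set coords := hφ.implicitToOpenPartialHomeomorph φ φ' hφ'
  obtain ⟨L, s, hs, hL⟩ := (hφ.to_implicitFunction hφ').exists_lipschitzOnWith
  obtain ⟨ε, hε, hball⟩ := Metric.mem_nhds_iff.mp hs
  refine ⟨Ψ '' Metric.ball 0 ε, ?_, ?_⟩
  · have hcoords : Filter.Tendsto (fun y => (coords y).2) (𝓝 x) (𝓝 0) := by
      have h := coords.continuousAt (hφ.mem_implicitToOpenPartialHomeomorph_source hφ')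
      rw [ContinuousAt, hφ.implicitToOpenPartialHomeomorph_self hφ'] at h
      exact (continuous_snd.tendsto _).comp h
    have hmem := hcoords.eventually (Metric.ball_mem_nhds 0 hε)
    filter_upwards [hmem.filter_mono nhdsWithin_le_nhds,
      (hφ.eq_implicitFunction hφ').filter_mono nhdsWithin_le_nhds, self_mem_nhdsWithin]
      with y hy hyΨ hyφ
    exact ⟨(coords y).2, hy, by rwa [Set.mem_ofPred_eq.mp hyφ] at hyΨ⟩
  · have hlip := (hL.mono hball).hausdorffMeasure_image_le (d := Module.finrank ℝ φ'.ker)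
      (by positivity)
    have hfin : Measure.hausdorffMeasure (Module.finrank ℝ φ'.ker : ℝ)
        (Metric.ball (0 : φ'.ker) ε) < ⊤ := measure_ball_lt_top
    rw [Measure.euclideanHausdorffMeasure_def, Measure.smul_apply, ENNReal.smul_def, smul_eq_mul]
    refine ENNReal.mul_lt_top ENNReal.coe_lt_top (hlip.trans_lt (ENNReal.mul_lt_top ?_ hfin))
    exact ENNReal.rpow_lt_top_of_nonneg (by positivity) ENNReal.coe_ne_top

end LevelSet

section RadialStability

variable {n : ℕ} {m R : ℝ} {φ : ℝ → ℝ}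

lemma hasDerivAt_schwProfile_mul_self_pow (hn : 2 < n) (hm : 0 < m) {r : ℝ} (hr : 0 < r) (q : ℕ) :
    HasDerivAt (fun r => (schwProfile n m r * r) ^ q)
      (q * (schwProfile n m r * r) ^ q * schwTau n m r / r) r := by
  refine (((hasDerivAt_schwProfile hn hm hr).fun_mul (hasDerivAt_id r)).fun_pow q).congr_deriv ?_
  rcases q with _ | q
  · simp
  · simp only [id, Nat.add_sub_cancel, pow_succ]
    field_simp
    ring

/-- The integrand of the second variation along a ray, for a function `φ` of the radius, after
the term of order zero has been enlarged to `(n - 2) / 2 * (1 - τ²) + Λ`. -/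
noncomputable def radialEnergyDensity (n : ℕ) (m Λ : ℝ) (φ : ℝ → ℝ) (r : ℝ) : ℝ :=
  (schwProfile n m r * r) ^ (n - 3) * (r * deriv φ r ^ 2 -
    (((n : ℝ) - 2) / 2 * (1 - schwTau n m r ^ 2) + Λ) * φ r ^ 2 / r)

/-- The primitive whose derivative is compared with the second variation along a ray; it comes
from the supersolution `(f r)⁻ᵝ`. -/
noncomputable def stabilityPrimitive (n : ℕ) (m β : ℝ) (φ : ℝ → ℝ) (r : ℝ) : ℝ :=
  -β * (schwTau n m r * (schwProfile n m r * r) ^ (n - 3) * φ r ^ 2)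

lemma hasDerivAt_stabilityPrimitive (hn : 2 < n) (hm : 0 < m) (β : ℝ) {r : ℝ} (hr : 0 < r)
    (hφ : DifferentiableAt ℝ φ r) :
    HasDerivAt (stabilityPrimitive n m β φ)
      (-β * (schwProfile n m r * r) ^ (n - 3) *
        ((((n : ℝ) - 2) / 2 * (1 - schwTau n m r ^ 2) + ((n : ℝ) - 3) * schwTau n m r ^ 2) *
          φ r ^ 2 / r + 2 * schwTau n m r * φ r * deriv φ r)) r := by
  have h := (((hasDerivAt_schwTau hn hm hr).fun_mul
    (hasDerivAt_schwProfile_mul_self_pow hn hm hr (n - 3))).fun_mul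
      (hφ.hasDerivAt.fun_pow 2)).const_mul (-β)
  refine h.congr_deriv ?_
  rw [Nat.cast_sub (by omega)]
  push_cast
  field_simp

/-- Completing the square shows that the difference is a sum of nonnegative terms. -/
lemma deriv_stabilityPrimitive_le (hn : 2 < n) (hm : 0 < m) {β Λ : ℝ}
    (hΛ : Λ ≤ (β - 1) * ((n : ℝ) - 2) / 2) (hΛ' : Λ ≤ β * ((n : ℝ) - 3 - β)) {r : ℝ} (hr : 0 < r)
    (hφ : DifferentiableAt ℝ φ r) :
    deriv (stabilityPrimitive n m β φ) r ≤ radialEnergyDensity n m Λ φ r := by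
  have hf : 0 < schwProfile n m r := schwProfile_pos hm hr
  have hτ : 0 ≤ 1 - schwTau n m r ^ 2 := sub_nonneg.mpr (schwTau_sq_le_one hm hr)
  have hsq : radialEnergyDensity n m Λ φ r - deriv (stabilityPrimitive n m β φ) r =
      (schwProfile n m r * r) ^ (n - 3) / r *
        ((r * deriv φ r + β * schwTau n m r * φ r) ^ 2 +
          (((β - 1) * ((n : ℝ) - 2) / 2 - Λ) * (1 - schwTau n m r ^ 2) +
            (β * ((n : ℝ) - 3 - β) - Λ) * schwTau n m r ^ 2) * φ r ^ 2) := by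
    rw [(hasDerivAt_stabilityPrimitive hn hm β hr hφ).deriv, radialEnergyDensity]
    field_simp
    ring
  have : 0 ≤ (β - 1) * ((n : ℝ) - 2) / 2 - Λ := sub_nonneg.mpr hΛ
  have : 0 ≤ β * ((n : ℝ) - 3 - β) - Λ := sub_nonneg.mpr hΛ'
  rw [← sub_nonneg, hsq]
  positivity

lemma continuousOn_radialEnergyDensity (hn : 2 < n) (hm : 0 < m) (Λ : ℝ) (hφ : ContDiff ℝ 1 φ) :
    ContinuousOn (radialEnergyDensity n m Λ φ) (Set.Ioi 0) := by
  have hf : ContinuousOn (schwProfile n m) (Set.Ioi 0) := fun r hr =>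
    (hasDerivAt_schwProfile hn hm hr).continuousAt.continuousWithinAt
  have hτ : ContinuousOn (schwTau n m) (Set.Ioi 0) := fun r hr =>
    (hasDerivAt_schwTau hn hm hr).continuousAt.continuousWithinAt
  have hφ₀ := hφ.continuous
  have : Continuous (deriv φ) := hφ.continuous_deriv le_rfl
  have hinv : ContinuousOn (fun r : ℝ => r⁻¹) (Set.Ioi 0) :=
    continuousOn_inv₀.mono fun r hr => ne_of_gt hr
  unfold radialEnergyDensity
  simp only [div_eq_mul_inv]
  fun_prop

lemma integral_radialEnergyDensity_nonneg (hn : 2 < n) (hm : 0 < m) {β Λ : ℝ}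
    (hΛ : Λ ≤ (β - 1) * ((n : ℝ) - 2) / 2) (hΛ' : Λ ≤ β * ((n : ℝ) - 3 - β))
    (hR : horizonRadius n m ≤ R) (hφ : ContDiff ℝ 1 φ) (hφR : φ R = 0) :
    0 ≤ ∫ r in horizonRadius n m..R, radialEnergyDensity n m Λ φ r := by
  have hpos : ∀ r ∈ Set.Icc (horizonRadius n m) R, 0 < r := fun r hr =>
    (horizonRadius_pos n hm).trans_le hr.1
  have hderiv : ∀ r ∈ Set.Icc (horizonRadius n m) R, HasDerivAt (stabilityPrimitive n m β φ)
      (deriv (stabilityPrimitive n m β φ) r) r := fun r hr =>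
    (hasDerivAt_stabilityPrimitive hn hm β (hpos r hr)
      (hφ.differentiable one_ne_zero r)).differentiableAt.hasDerivAt
  have h := intervalIntegral.sub_le_integral_of_hasDeriv_right_of_le hR
    (fun r hr => (hderiv r hr).continuousAt.continuousWithinAt)
    (fun r hr => (hderiv r (Set.Ioo_subset_Icc_self hr)).hasDerivWithinAt)
    (((continuousOn_radialEnergyDensity hn hm Λ hφ).mono hpos).integrableOn_compact isCompact_Icc)
    fun r hr => deriv_stabilityPrimitive_le hn hm hΛ hΛ' (hpos r (Set.Ioo_subset_Icc_self hr))
      (hφ.differentiable one_ne_zero r)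
  simpa [stabilityPrimitive, hφR, schwTau_horizonRadius hn hm] using h

end RadialStability

section RadialIndexDensity

variable {n : ℕ} {m Λ R : ℝ} {u : Euc n → ℝ}

/-- The integrand of the second variation on a cone after the tangential gradient has been replaced
by the radial derivative; `Λ` stands for `|A|²` of the link. -/
noncomputable def radialIndexDensity (n : ℕ) (m Λ : ℝ) (u : Euc n → ℝ) (x : Euc n) : ℝ :=
  schwFactor n m x ^ (n - 3) * (fderiv ℝ u x x ^ 2 / ‖x‖ ^ 2 -
    (((n : ℝ) - 2) / 2 * (1 - schwTau n m ‖x‖ ^ 2) + Λ) * u x ^ 2 / ‖x‖ ^ 2)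

lemma measurable_radialIndexDensity (hu : ContDiff ℝ 1 u) :
    Measurable (radialIndexDensity n m Λ u) := by
  have : Measurable fun x => fderiv ℝ u x x :=
    ((hu.continuous_fderiv one_ne_zero).clm_apply continuous_id).measurable
  have := hu.continuous.measurable
  unfold radialIndexDensity schwFactor schwTau
  fun_prop

lemma continuousOn_radialIndexDensity (hn : 2 < n) (hm : 0 < m) (hu : ContDiff ℝ 1 u) :
    ContinuousOn (radialIndexDensity n m Λ u) {x | x ≠ 0} := by
  have : Continuous fun x => fderiv ℝ u x x :=
    (hu.continuous_fderiv one_ne_zero).clm_apply continuous_id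
  have := hu.continuous
  have : ContinuousOn (schwFactor n m) {x | x ≠ 0} := fun x hx =>
    (contDiffAt_schwFactor hm hx).continuousAt.continuousWithinAt
  have : ContinuousOn (fun x : Euc n => schwTau n m ‖x‖) {x | x ≠ 0} := fun x hx =>
    ((hasDerivAt_schwTau hn hm (norm_pos_iff.mpr hx)).continuousAt.comp
      continuous_norm.continuousAt).continuousWithinAt
  have : ContinuousOn (fun x : Euc n => (‖x‖ ^ 2)⁻¹) {x | x ≠ 0} :=
    ContinuousOn.inv₀ (by fun_prop) fun x hx => pow_ne_zero 2 (norm_ne_zero_iff.mpr hx)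
  unfold radialIndexDensity
  simp only [div_eq_mul_inv]
  fun_prop

lemma pow_mul_radialIndexDensity_smul (hn : 2 < n) (hu : ContDiff ℝ 1 u) {θ : Euc n}
    (hθ : ‖θ‖ = 1) {r : ℝ} (hr : 0 < r) :
    r ^ (n - 2) * radialIndexDensity n m Λ u (r • θ) =
      radialEnergyDensity n m Λ (fun s => u (s • θ)) r := by
  have hsmul : HasDerivAt (fun s : ℝ => s • θ) θ r := by
    simpa using (hasDerivAt_id r).smul_const θ
  have hderiv : HasDerivAt (fun s => u (s • θ)) (fderiv ℝ u (r • θ) θ) r :=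
    (hu.differentiable one_ne_zero _).hasFDerivAt.comp_hasDerivAt r hsmul
  have hnorm : ‖r • θ‖ = r := by rw [norm_smul_of_nonneg hr.le, hθ, mul_one]
  have hf : schwFactor n m (r • θ) = schwProfile n m r := congrArg (schwProfile n m) hnorm
  have hpow : r ^ (n - 2) = r ^ (n - 3) * r := by rw [← pow_succ, show n - 3 + 1 = n - 2 by omega]
  rw [radialIndexDensity, radialEnergyDensity, hderiv.deriv, hf, hnorm, hpow, map_smul, smul_eq_mul,
    mul_pow (schwProfile n m r)]
  field_simp

lemma integral_ray_radialIndexDensity_nonneg (hn : 2 < n) (hm : 0 < m) {β : ℝ}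
    (hΛ : Λ ≤ (β - 1) * ((n : ℝ) - 2) / 2) (hΛ' : Λ ≤ β * ((n : ℝ) - 3 - β))
    (hR : horizonRadius n m ≤ R) (hu : ContDiff ℝ 1 u) {θ : Euc n} (hθ : ‖θ‖ = 1)
    (huR : u (R • θ) = 0) :
    0 ≤ ∫ r in Set.Icc (horizonRadius n m) R,
      r ^ (n - 2) * radialIndexDensity n m Λ u (r • θ) := by
  have hφ : ContDiff ℝ 1 fun r : ℝ => u (r • θ) := hu.comp (contDiff_id.smul contDiff_const)
  have h := integral_radialEnergyDensity_nonneg hn hm hΛ hΛ' hR hφ huR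
  rw [intervalIntegral.integral_of_le hR, ← integral_Icc_eq_integral_Ioc] at h
  rwa [setIntegral_congr_fun measurableSet_Icc fun r hr =>
    pow_mul_radialIndexDensity_smul hn hu hθ ((horizonRadius_pos n hm).trans_le hr.1)]

end RadialIndexDensity

section ConeStability

variable {n : ℕ} {D : Euc n →L[ℝ] Euc n} {α m R : ℝ} {u : Euc n → ℝ} {x : Euc n}

/-- The cone `⟪x, D x⟫ = 0` without its apex, at which it is not a hypersurface. -/
def puncturedQuadricCone (D : Euc n →L[ℝ] Euc n) : Set (Euc n) := {x | x ≠ 0 ∧ ⟪x, D x⟫_ℝ = 0}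

lemma measurableSet_puncturedQuadricCone (D : Euc n →L[ℝ] Euc n) :
    MeasurableSet (puncturedQuadricCone D) :=
  (measurableSet_singleton 0).compl.inter
    (isClosed_eq (contDiff_inner_self_map D).continuous continuous_const).measurableSet

lemma smul_mem_puncturedQuadricCone_iff {t : ℝ} (ht : 0 < t) (x : Euc n) :
    t • x ∈ puncturedQuadricCone D ↔ x ∈ puncturedQuadricCone D := by
  rw [puncturedQuadricCone, Set.mem_ofPred_eq, inner_self_map_smul, Set.mem_ofPred_eq]
  simp [ht.ne']

lemma quadricCone_subset_puncturedQuadricCone {R₀ : ℝ} (hR : 0 < R₀) :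
    quadricCone R₀ D ⊆ puncturedQuadricCone D := fun _ hx =>
  ⟨ne_zero_of_mem_quadricCone hR hx, hx.2⟩

lemma isCompact_quadricCone_inter (a b : ℝ) (D : Euc n →L[ℝ] Euc n) :
    IsCompact (quadricCone a D ∩ {x | ‖x‖ ≤ b}) := by
  have h := (isCompact_closedBall (0 : Euc n) b).inter_left (isClosed_quadricCone a D)
  simpa only [Metric.closedBall, dist_zero_right] using h

lemma smul_mem_quadricCone_inter_iff {θ : Euc n} (hθ : θ ∈ quadricLink D) {a b t : ℝ}
    (ht : 0 ≤ t) : t • θ ∈ quadricCone a D ∩ {x | ‖x‖ ≤ b} ↔ t ∈ Set.Icc a b := by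
  have hnorm : ‖t • θ‖ = t := by rw [norm_smul_of_nonneg ht, hθ.1, mul_one]
  have hq : ⟪t • θ, D (t • θ)⟫_ℝ = 0 := by rw [inner_self_map_smul, hθ.2, mul_zero]
  simp only [quadricCone, Set.mem_inter_iff, Set.mem_ofPred_eq, hnorm, hq, and_true, Set.mem_Icc]

lemma integral_ray_indicator_radialIndexDensity_nonneg (hn : 2 < n) (hm : 0 < m) {β Λ : ℝ}
    (hΛ : Λ ≤ (β - 1) * ((n : ℝ) - 2) / 2) (hΛ' : Λ ≤ β * ((n : ℝ) - 3 - β))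
    (hR : horizonRadius n m ≤ R) (hu : ContDiff ℝ 1 u)
    (huR : ∀ x ∈ quadricCone (horizonRadius n m) D, ‖x‖ = R → u x = 0) {θ : Euc n}
    (hθ : θ ∈ quadricLink D) :
    0 ≤ ∫ t in Set.Ioi (0 : ℝ), t ^ (n - 2) *
      (quadricCone (horizonRadius n m) D ∩ {x | ‖x‖ ≤ R}).indicator
        (radialIndexDensity n m Λ u) (t • θ) := by
  have hR₀ := horizonRadius_pos n hm
  have hRθ : u (R • θ) = 0 :=
    have ⟨hcone, hnorm⟩ := smul_mem_quadricCone (hR₀.le.trans hR) hθ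
    huR _ ⟨hR.trans_eq hnorm.symm, hcone.2⟩ hnorm
  have hsub : Set.Icc (horizonRadius n m) R ⊆ Set.Ioi 0 := fun t ht => hR₀.trans_le ht.1
  have hray := integral_ray_radialIndexDensity_nonneg hn hm hΛ hΛ' hR hu hθ.1 hRθ
  rw [← Set.inter_eq_self_of_subset_right hsub, ← setIntegral_indicator measurableSet_Icc] at hray
  refine hray.trans_eq (setIntegral_congr_fun measurableSet_Ioi fun t (ht : 0 < t) => ?_)
  have hmem := smul_mem_quadricCone_inter_iff hθ (a := horizonRadius n m) (b := R) ht.le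
  by_cases htA : t ∈ Set.Icc (horizonRadius n m) R
  · simp only [Set.indicator_of_mem htA, Set.indicator_of_mem (hmem.mpr htA)]
  · simp only [Set.indicator_of_notMem htA, Set.indicator_of_notMem (htA ∘ hmem.mp), mul_zero]

namespace IsCliffordOp

lemma finiteAtFilter_puncturedQuadricCone (h : IsCliffordOp D α)
    (hx : x ∈ puncturedQuadricCone D) :
    (Measure.euclideanHausdorffMeasure (n - 1) : Measure (Euc n)).FiniteAtFilter
      (𝓝[puncturedQuadricCone D] x) := by
  have hφ := (contDiff_inner_self_map D).contDiffAt.hasStrictFDerivAt (x := x) (by simp)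
  have hne : (fderiv ℝ (fun y => ⟪y, D y⟫_ℝ) x).toLinearMap ≠ 0 := by
    intro hzero
    have hDx := h.fderiv_inner_self_map x (D x)
    rw [← ContinuousLinearMap.coe_coe, hzero, real_inner_self_eq_norm_sq, h.norm_map hx.2] at hDx
    have := norm_ne_zero_iff.mpr hx.1
    simp_all
  have hdim := Module.Dual.finrank_ker_add_one_of_ne_zero hne
  rw [finrank_euclideanSpace_fin] at hdim
  have hfin := finiteAtFilter_levelSet_of_hasStrictFDerivAt hφ
    (Module.Dual.range_eq_top_of_ne_zero hne)
  rw [hx.2, show Module.finrank ℝ (fderiv ℝ (fun y => ⟪y, D y⟫_ℝ) x).ker = n - 1 from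
    Nat.eq_sub_of_add_eq hdim] at hfin
  exact hfin.filter_mono (nhdsWithin_mono x fun y hy => hy.2)

lemma integral_radialIndexDensity_nonneg (h : IsCliffordOp D α) (hn : 2 < n) (hm : 0 < m) {β Λ : ℝ}
    (hΛ : Λ ≤ (β - 1) * ((n : ℝ) - 2) / 2) (hΛ' : Λ ≤ β * ((n : ℝ) - 3 - β))
    (hR : horizonRadius n m ≤ R) (hu : ContDiff ℝ 1 u)
    (huR : ∀ x ∈ quadricCone (horizonRadius n m) D, ‖x‖ = R → u x = 0) :
    0 ≤ ∫ x in quadricCone (horizonRadius n m) D ∩ {x | ‖x‖ ≤ R}, radialIndexDensity n m Λ u x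
      ∂(Measure.euclideanHausdorffMeasure (n - 1)) := by
  have hR₀ := horizonRadius_pos n hm
  set A := quadricCone (horizonRadius n m) D ∩ {x | ‖x‖ ≤ R}
  have hA : MeasurableSet A := (isCompact_quadricCone_inter _ _ D).measurableSet
  have hsub : A ⊆ puncturedQuadricCone D := fun x hx =>
    quadricCone_subset_puncturedQuadricCone hR₀ hx.1
  have hν := isHomogeneousMeasure_euclideanHausdorffMeasure_restrict (n - 2 + 1)
    fun t ht => smul_mem_puncturedQuadricCone_iff (D := D) ht
  have hσ := sigmaFinite_restrict_of_finiteAtFilter (measurableSet_puncturedQuadricCone D)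
    fun x hx => h.finiteAtFilter_puncturedQuadricCone hx
  rw [show n - 1 = n - 2 + 1 by omega] at hσ ⊢
  rw [← Set.inter_eq_self_of_subset_left hsub, ← Measure.restrict_restrict hA,
    ← integral_indicator hA]
  refine hν.integral_nonneg_of_ae_ray ((measurable_radialIndexDensity hu).indicator hA)
    (Set.indicator_of_notMem (fun h₀ => (hsub h₀).1 rfl) _) ?_
  filter_upwards [ae_restrict_of_ae
    (ae_restrict_mem (measurableSet_puncturedQuadricCone D))] with x hx
  refine integral_ray_nonneg_of_normalized hx.1 ?_
  have hθ := (smul_mem_puncturedQuadricCone_iff (inv_pos.mpr (norm_pos_iff.mpr hx.1)) x).mpr hx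
  exact integral_ray_indicator_radialIndexDensity_nonneg hn hm hΛ hΛ' hR hu huR
    ⟨norm_smul_inv_norm (𝕜 := ℝ) hx.1, hθ.2⟩

lemma radialIndexDensity_le (h : IsCliffordOp D α) (hn : 2 < n) (hm : 0 < m) (hx₀ : x ≠ 0)
    (hx : ⟪x, D x⟫_ℝ = 0) (u : Euc n → ℝ) :
    radialIndexDensity n m ((n : ℝ) - 2) u x ≤
      (normSqTanGrad (schwMetric n m) (coneNormal n m D) u x
        - (ricciCurvature (schwMetric n m) x (coneNormal n m D x) (coneNormal n m D x)
          + normSqA (schwMetric n m) (coneNormal n m D) x) * u x ^ 2)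
        * schwFactor n m x ^ (n - 1) := by
  have : 0 < ‖x‖ := norm_pos_iff.mpr hx₀
  have hf := schwFactor_pos hm hx₀
  have hnorm : ‖coneNormal n m D x‖ ^ 2 = (schwFactor n m x ^ 2)⁻¹ := by
    have hself := (conformalMetric_self _).symm.trans (h.schwMetric_coneNormal_self hm hx₀ hx)
    rw [mul_pow] at hself
    exact eq_inv_of_mul_eq_one_right hself
  have hgrad : fderiv ℝ u x x ^ 2 / (schwFactor n m x * ‖x‖) ^ 2 ≤
      normSqTanGrad (schwMetric n m) (coneNormal n m D) u x := by
    rw [div_le_iff₀ (by positivity), ← conformalMetric_self]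
    exact sq_fderiv_le_normSqTanGrad_mul hf.ne'
      ((real_inner_comm _ _).trans (inner_coneNormal hx)) u
  have hpow : schwFactor n m x ^ (n - 1) = schwFactor n m x ^ (n - 3) * schwFactor n m x ^ 2 := by
    rw [← pow_add, show n - 3 + 2 = n - 1 by omega]
  rw [ricciCurvature_schwMetric hn hm hx₀ (inner_coneNormal hx),
    h.normSqA_coneNormal hn hm hx₀ hx, hnorm]
  calc radialIndexDensity n m ((n : ℝ) - 2) u x
    _ = (fderiv ℝ u x x ^ 2 / (schwFactor n m x * ‖x‖) ^ 2 -
          (((n : ℝ) - 2) / 2 * (1 - schwTau n m ‖x‖ ^ 2) / ‖x‖ ^ 2 * (schwFactor n m x ^ 2)⁻¹ +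
            ((n : ℝ) - 2) / (schwFactor n m x * ‖x‖) ^ 2) * u x ^ 2) *
          schwFactor n m x ^ (n - 1) := by
      rw [hpow, radialIndexDensity]
      field_simp
    _ ≤ _ := by gcongr

lemma integrableOn_radialIndexDensity (h : IsCliffordOp D α) (hn : 2 < n) (hm : 0 < m) {a : ℝ}
    (ha : 0 < a) (b Λ : ℝ) (hu : ContDiff ℝ 1 u) :
    IntegrableOn (radialIndexDensity n m Λ u) (quadricCone a D ∩ {x | ‖x‖ ≤ b})
      (Measure.euclideanHausdorffMeasure (n - 1)) := by
  have hK := isCompact_quadricCone_inter a b D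
  have hsub : quadricCone a D ∩ {x | ‖x‖ ≤ b} ⊆ puncturedQuadricCone D := fun x hx =>
    quadricCone_subset_puncturedQuadricCone ha hx.1
  have hfin := hK.measure_lt_top_of_nhdsWithin fun x hx =>
    (h.finiteAtFilter_puncturedQuadricCone (hsub hx)).filter_mono (nhdsWithin_mono x hsub)
  exact ContinuousOn.integrableOn_of_subset_isCompact
    ((continuousOn_radialIndexDensity hn hm hu).mono fun x hx => (hsub hx).1)
    hK hK.measurableSet subset_rfl hfin.ne

lemma indexForm_quadricCone_nonneg (h : IsCliffordOp D α) (hn : 8 ≤ n) (hm : 0 < m)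
    (hR : horizonRadius n m ≤ R) (hu : ContDiff ℝ 1 u)
    (huR : ∀ x ∈ quadricCone (horizonRadius n m) D, ‖x‖ = R → u x = 0) :
    0 ≤ indexForm n m (quadricCone (horizonRadius n m) D) (coneNormal n m D) R u := by
  have hn₂ : 2 < n := by omega
  have hn₈ : (8 : ℝ) ≤ n := by exact_mod_cast hn
  have hR₀ := horizonRadius_pos n hm
  have hhorizon : ∫ x in quadricCone (horizonRadius n m) D ∩ {x | ‖x‖ = horizonRadius n m},
      secondFF (schwMetric n m) (radialNormal n m) x (coneNormal n m D x) (coneNormal n m D x) *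
        u x ^ 2 * schwFactor n m x ^ (n - 2) ∂(Measure.euclideanHausdorffMeasure (n - 2)) = 0 := by
    refine setIntegral_eq_zero_of_forall_eq_zero fun x ⟨hx, hxR⟩ => ?_
    rw [secondFF_radialNormal hn₂ hm (ne_zero_of_mem_quadricCone hR₀ hx)
      (inner_coneNormal hx.2), hxR, schwTau_horizonRadius hn₂ hm]
    ring
  rw [indexForm, hhorizon, sub_zero]
  -- `β = 3` is admissible as soon as `n - 2 ≤ 3 * (n - 6)`, that is `8 ≤ n`.
  have hradial := h.integral_radialIndexDensity_nonneg (β := 3) (Λ := (n : ℝ) - 2) hn₂ hm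
    (by linarith) (by linarith) hR hu huR
  by_contra! hneg
  refine hneg.not_ge (hradial.trans (setIntegral_mono_on
    (h.integrableOn_radialIndexDensity hn₂ hm hR₀ R _ hu) (Integrable.of_integral_ne_zero hneg.ne)
    (isCompact_quadricCone_inter _ _ D).measurableSet fun x hx =>
      h.radialIndexDensity_le hn₂ hm (ne_zero_of_mem_quadricCone hR₀ hx.1) hx.1.2 u))

lemma morseIndexAt_quadricCone (h : IsCliffordOp D α) (hn : 8 ≤ n) (hm : 0 < m)
    (hR : horizonRadius n m ≤ R) :
    morseIndexAt n m (quadricCone (horizonRadius n m) D) (coneNormal n m D) R = 0 := by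
  refine le_antisymm (iSup₂_le fun V hV => ?_) zero_le
  have hV₀ : V = ⊥ := by
    refine (Submodule.eq_bot_iff V).mpr fun v hv => ?_
    by_contra hv₀
    obtain ⟨u, hu, -, huR, hneg⟩ := hV v hv hv₀
    exact hneg.not_ge (h.indexForm_quadricCone_nonneg hn hm hR (hu.of_le (by simp)) huR)
  simp [hV₀]

lemma morseIndex_quadricCone (h : IsCliffordOp D α) (hn : 8 ≤ n) (hm : 0 < m) :
    morseIndex n m (quadricCone (horizonRadius n m) D) (coneNormal n m D) = 0 := by
  rw [morseIndex, Filter.limsup_congr ((Filter.eventually_ge_atTop (horizonRadius n m)).mono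
    fun _ => h.morseIndexAt_quadricCone hn hm), Filter.limsup_const]

end IsCliffordOp

end ConeStability

section CliffordTorus

variable {n k : ℕ} {α : ℝ}

/-- The diagonal operator with entries `α` on the first `k + 1` coordinates and `-α⁻¹` on the
others. -/
noncomputable def cliffordOp (n k : ℕ) (α : ℝ) : Euc n →L[ℝ] Euc n :=
  LinearMap.toContinuousLinearMap
    { toFun := fun x => WithLp.toLp 2 fun i => (if i.val < k + 1 then α else -α⁻¹) * x i
      map_add' := fun x y => by ext i; exact mul_add _ _ _
      map_smul' := fun c x => by ext i; exact mul_left_comm _ _ _ }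

/-- The ratio `√((n - 2 - k) / k)` of the radii of the two factors of the Clifford torus. -/
noncomputable def cliffordRatio (n k : ℕ) : ℝ := √(((n : ℝ) - 2 - k) / k)

lemma cliffordOp_apply (x : Euc n) (i : Fin n) :
    cliffordOp n k α x i = (if i.val < k + 1 then α else -α⁻¹) * x i := rfl

lemma coordTrace_cliffordOp (hkn : k + 1 ≤ n) :
    coordTrace (fun v => cliffordOp n k α v) = (k + 1) * α - ((n : ℝ) - (k + 1)) * α⁻¹ := by
  have hsum : coordTrace (fun v => cliffordOp n k α v) =
      ∑ i : Fin n, if i.val < k + 1 then α else -α⁻¹ := by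
    simp [coordTrace, cliffordOp_apply, stdVec]
  obtain ⟨l, rfl⟩ := Nat.exists_eq_add_of_le hkn
  have hleft (i : Fin (k + 1)) : (Fin.castAdd l i).val < k + 1 := i.2
  have hright (i : Fin l) : ¬ (Fin.natAdd (k + 1) i).val < k + 1 := by
    simp only [Fin.val_natAdd]
    omega
  rw [hsum, Fin.sum_univ_add, Fintype.sum_congr _ _ fun i => if_pos (hleft i),
    Fintype.sum_congr _ _ fun i => if_neg (hright i)]
  simp
  ring

lemma norm_sq_eq_blockSum_add_blockSum (k : ℕ) (x : Euc n) :
    ‖x‖ ^ 2 = (∑ i : Fin n, if i.val < k + 1 then x i ^ 2 else 0) +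
      ∑ i : Fin n, if i.val < k + 1 then 0 else x i ^ 2 := by
  rw [EuclideanSpace.real_norm_sq_eq, ← Finset.sum_add_distrib]
  refine Finset.sum_congr rfl fun i _ => ?_
  split_ifs <;> simp

lemma inner_self_cliffordOp (x : Euc n) :
    ⟪x, cliffordOp n k α x⟫_ℝ = α * (∑ i : Fin n, if i.val < k + 1 then x i ^ 2 else 0) -
      α⁻¹ * ∑ i : Fin n, if i.val < k + 1 then 0 else x i ^ 2 := by
  rw [PiLp.inner_apply, Finset.mul_sum, Finset.mul_sum, ← Finset.sum_sub_distrib]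
  refine Finset.sum_congr rfl fun i _ => ?_
  rw [cliffordOp_apply]
  split_ifs <;> simp <;> ring

lemma cliffordRatio_pos (hk : 1 ≤ k) (hkn : k + 3 ≤ n) : 0 < cliffordRatio n k := by
  have hk' : (1 : ℝ) ≤ k := by exact_mod_cast hk
  have hkn' : (k : ℝ) + 3 ≤ n := by exact_mod_cast hkn
  exact Real.sqrt_pos.mpr (div_pos (by linarith) (by linarith))

lemma mul_cliffordRatio_sq (hk : 1 ≤ k) (hkn : k + 2 ≤ n) :
    k * cliffordRatio n k ^ 2 = (n : ℝ) - 2 - k := by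
  have hk' : (1 : ℝ) ≤ k := by exact_mod_cast hk
  have hkn' : (k : ℝ) + 2 ≤ n := by exact_mod_cast hkn
  rw [cliffordRatio, Real.sq_sqrt (div_nonneg (by linarith) (by linarith))]
  field_simp

lemma isCliffordOp_cliffordOp (hk : 1 ≤ k) (hkn : k + 3 ≤ n) :
    IsCliffordOp (cliffordOp n k (cliffordRatio n k)) (cliffordRatio n k) where
  pos := cliffordRatio_pos hk hkn
  symm x y := by
    simp only [PiLp.inner_apply, cliffordOp_apply]
    refine Finset.sum_congr rfl fun i _ => ?_
    simp only [RCLike.inner_apply, conj_trivial]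
    ring
  sq x := by
    have hα := (cliffordRatio_pos hk hkn).ne'
    ext i
    simp only [cliffordOp_apply, PiLp.add_apply, PiLp.smul_apply, smul_eq_mul]
    split_ifs <;> field_simp <;> ring
  trace := by
    have hα := cliffordRatio_pos hk hkn
    rw [coordTrace_cliffordOp (by omega)]
    field_simp
    linear_combination mul_cliffordRatio_sq (n := n) hk (by omega)

lemma quadricLink_cliffordOp (hk : 1 ≤ k) (hkn : k + 3 ≤ n) :
    quadricLink (cliffordOp n k (cliffordRatio n k)) = cliffordTorus n k := by
  have hα := cliffordRatio_pos hk hkn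
  have hratio := mul_cliffordRatio_sq (n := n) hk (by omega)
  have hkn' : (k : ℝ) + 3 ≤ n := by exact_mod_cast hkn
  have hn : (n : ℝ) - 2 ≠ 0 := by linarith
  ext x
  change ‖x‖ = 1 ∧ ⟪x, cliffordOp n k (cliffordRatio n k) x⟫_ℝ = 0 ↔ _ = _ ∧ _ = _
  rw [← sq_eq_sq₀ (norm_nonneg x) zero_le_one, norm_sq_eq_blockSum_add_blockSum k,
    inner_self_cliffordOp, eq_div_iff hn, eq_div_iff hn]
  generalize cliffordRatio n k = α at *
  generalize (∑ i : Fin n, if i.val < k + 1 then x i ^ 2 else 0) = s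
  generalize (∑ i : Fin n, if i.val < k + 1 then 0 else x i ^ 2) = t
  have hquadric : α * s - α⁻¹ * t = 0 ↔ α ^ 2 * s = t := by
    rw [sub_eq_zero, eq_inv_mul_iff_mul_eq₀ hα.ne', ← mul_assoc, ← sq]
  rw [hquadric]
  constructor
  · rintro ⟨hsum, rfl⟩
    constructor
    · linear_combination k * hsum - s * hratio
    · linear_combination ((n : ℝ) - 2 - k) * hsum + s * hratio
  · rintro ⟨hs, ht⟩
    constructor <;> apply mul_right_cancel₀ hn
    · linear_combination hs + ht
    · linear_combination α ^ 2 * hs - ht + hratio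

lemma cliffordTorus_nonempty (hkn : k + 3 ≤ n) : (cliffordTorus n k).Nonempty := by
  have hkn' : (k : ℝ) + 3 ≤ n := by exact_mod_cast hkn
  let i : Fin n := ⟨0, by omega⟩
  let j : Fin n := ⟨k + 1, by omega⟩
  have hij : i ≠ j := by simp [i, j]
  have hi : i.val < k + 1 := k.succ_pos
  have hj : ¬ j.val < k + 1 := lt_irrefl _
  have hs : 0 ≤ (k : ℝ) / ((n : ℝ) - 2) := div_nonneg k.cast_nonneg (by linarith)
  have ht : 0 ≤ ((n : ℝ) - 2 - k) / ((n : ℝ) - 2) := div_nonneg (by linarith) (by linarith)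
  refine ⟨EuclideanSpace.single i √((k : ℝ) / ((n : ℝ) - 2)) +
    EuclideanSpace.single j √(((n : ℝ) - 2 - k) / ((n : ℝ) - 2)), ?_, ?_⟩
  · rw [Finset.sum_eq_single i (fun l _ hl => ?_) (by simp)]
    · simp [hi, hij, Real.sq_sqrt hs, -Real.sqrt_div', -Real.sqrt_div]
    · rcases eq_or_ne l j with rfl | hlj
      · simp [hj]
      · simp [hl, hlj]
  · rw [Finset.sum_eq_single j (fun l _ hl => ?_) (by simp)]
    · simp [hj, hij.symm, Real.sq_sqrt ht, -Real.sqrt_div', -Real.sqrt_div]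
    · rcases eq_or_ne l i with rfl | hli
      · simp [hi]
      · simp [hl, hli]

end CliffordTorus

theorem mainTheorem4 (n : ℕ) (hn : 8 ≤ n) (m : ℝ) (hm : 0 < m) :
    (∃ (S : Set (Euc n)) (ξ : Euc n → Euc n), IsFreeBoundaryMinimal n m S ξ ∧
      ¬ IsTotallyGeodesic (schwMetric n m) S ξ ∧ morseIndex n m S ξ = 0) ∧
    ∀ k : ℕ, 1 ≤ k → k + 3 ≤ n →
      (∃ η : Euc n → Euc n, IsClosedMinimalInSphere (cliffordTorus n k) η ∧
        (∀ p ∈ cliffordTorus n k, sphNormSqA η p = (n : ℝ) - 2) ∧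
        IsLeast {μ : ℝ | IsJacobiEigenvalue (cliffordTorus n k) η μ} (-((n : ℝ) - 2))) ∧
      ∃ ξ : Euc n → Euc n,
        IsFreeBoundaryMinimal n m (truncatedCone (horizonRadius n m) (cliffordTorus n k)) ξ ∧
        ¬ IsTotallyGeodesic (schwMetric n m)
          (truncatedCone (horizonRadius n m) (cliffordTorus n k)) ξ ∧
        morseIndex n m (truncatedCone (horizonRadius n m) (cliffordTorus n k)) ξ = 0 := by
  refine (and_iff_right_of_imp fun hcone => ?_).mpr fun k hk hkn => ?_
  · obtain ⟨-, ξ, hξ⟩ := hcone 1 le_rfl (by omega)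
    exact ⟨_, ξ, hξ⟩
  · have h := isCliffordOp_cliffordOp hk hkn
    have hlink := cliffordTorus_nonempty hkn
    have hR := horizonRadius_pos n hm
    rw [← quadricLink_cliffordOp hk hkn] at hlink ⊢
    rw [truncatedCone_quadricLink hR]
    have hmin := h.isFreeBoundaryMinimal_quadricCone (by omega) hm hlink
    have hcone := hmin.properly_embedded.nonempty
    exact ⟨⟨_, h.isClosedMinimalInSphere_quadricLink hlink,
        fun _ => h.sphNormSqA_quadricLink, h.isLeast_isJacobiEigenvalue_quadricLink hlink⟩,
      _, hmin, h.not_isTotallyGeodesic_quadricCone (by omega) hm hR hcone,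
      h.morseIndex_quadricCone hn hm⟩
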